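/- Let $1\le p<\infty$, let $X$ be a metric space with a distinguished point $0$, and let $E$ be a real Banach space. For a real Banach space $Z$, $Lip_0(X;Z)$ denotes the space of Lipschitz maps $f:X\to Z$ with $f(0)=0$, and $Lip(f)=\sup_{x\ne y}\|f(x)-f(y)\|/d(x,y)$. A map $T\in Lip_0(X;E)$ is called strongly Lipschitz $p$-nuclear if $T=A\circ M_\lambda\circ b$ for some bounded linear operator $A:\ell_p\to E$, some $b\in Lip_0(X;\ell_\infty)$ and some diagonal operator $M_\lambda:\ell_\infty\to\ell_p$, $(a_n)_n\mapsto(\lambda_na_n)_n$, with $\lambda\in\ell_p$; then $sv_p^L(T)=\inf\|A\|\,\|M_\lambda\|\,Lip(b)$, the infimum being over all such factorizations. A map $L\in Lip_0(X;Z)$ is called strongly Lipschitz $p$-integral if there are a finite measure space $(\Omega,\Sigma,\mu)$, a bounded linear operator $A:L_p(\mu)\to Z^{**}$ and a map $b\in Lip_0(X;L_\infty(\mu))$ such that $K_Z\circ L=A\circ I_{\infty,p}\circ b$, where $K_Z:Z\to Z^{**}$ is the canonical embedding and $I_{\infty,p}:L_\infty(\mu)\to L_p(\mu)$ is the formal inclusion;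 then $si_p^L(L)=\inf\|A\|\,\|I_{\infty,p}\|\,Lip(b)$, the infimum being over all such factorizations. (For a probability measure $\mu$ one has $\|I_{\infty,p}\|=1$.) Theorem. A map $T\in Lip_0(X;E)$ is strongly Lipschitz $p$-nuclear if and only if there exist a Banach space $Z$, a compact linear operator $v:Z\to E$ and a strongly Lipschitz $p$-integral map $L:X\to Z$ such that $T=v\circ L$. In this case $$sv_p^L(T)=\inf\|v\|\,si_p^L(L),$$ where the infimum is taken over all such factorizations $T=v\circ L$. -/

import Mathlib

set_option maxSynthPendingDepth 3

open MeasureTheory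
open scoped ENNReal NNReal

universe u v w t

noncomputable section

/-- `f` belongs to `Lip₀(X; E)`: it is Lipschitz and vanishes at the base point `x₀`. -/
def IsLip0 {X : Type*} {E : Type*} [MetricSpace X] [NormedAddCommGroup E] (x₀ : X)
    (f : X → E) : Prop :=
  f x₀ = 0 ∧ ∃ K : ℝ≥0, LipschitzWith K f

/-- The Lipschitz norm `Lip(f) = sup_{x ≠ y} ‖f x - f y‖ / d(x, y)`
(it is `0` on a one-point space). -/
def lipNorm {X : Type*} {E : Type*} [MetricSpace X] [NormedAddCommGroup E] (f : X → E) : ℝ :=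
  sSup {r : ℝ | ∃ x y : X, x ≠ y ∧ r = ‖f x - f y‖ / dist x y}

/-- The sequence space `ℓ_p` of real sequences. -/
abbrev ellP (p : ℝ≥0∞) : Type := lp (fun _ : ℕ => ℝ) p

theorem memℓp_diag {p : ℝ≥0∞} (l : ellP p) (a : ellP ∞) :
    Memℓp (fun n => l n * a n) p := by
  refine Memℓp.mono' (g := fun n => ‖a‖ * l n) ((lp.memℓp l).const_mul ‖a‖) fun n => ?_
  rw [norm_mul, norm_mul, norm_norm, mul_comm]
  exact mul_le_mul_of_nonneg_right (lp.norm_apply_le_norm ENNReal.top_ne_zero a n) (norm_nonneg _)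

/-- The diagonal operator `M_l : ℓ_∞ → ℓ_p`, `(a_n) ↦ (l_n a_n)`, induced by `l ∈ ℓ_p`. -/
def diagOp {p : ℝ≥0∞} [Fact (1 ≤ p)] (l : ellP p) : ellP ∞ →L[ℝ] ellP p :=
  LinearMap.mkContinuous
    { toFun := fun a => ⟨fun n => l n * a n, memℓp_diag l a⟩
      map_add' := fun a b => by
        ext n
        exact mul_add _ _ _
      map_smul' := fun c a => by
        ext n
        exact mul_left_comm _ _ _ }
    ‖l‖ (fun a => by
      have hp : p ≠ 0 := (zero_lt_one.trans_le (Fact.out : 1 ≤ p)).ne'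
      have h := lp.norm_mono (p := p) hp
        (x := (⟨fun n => l n * a n, memℓp_diag l a⟩ : ellP p)) (y := ‖a‖ • l) fun n => by
          change ‖l n * a n‖ ≤ ‖‖a‖ * l n‖
          rw [norm_mul, norm_mul, norm_norm]
          rw [mul_comm]
          exact mul_le_mul_of_nonneg_right
            (lp.norm_apply_le_norm ENNReal.top_ne_zero a n) (norm_nonneg _)
      rw [norm_smul, norm_norm, mul_comm] at h
      exact h)

/-- The formal inclusion `I_{∞,p} : L_∞(μ) → L_p(μ)` of a finite measure space. -/
def inclLinftyLp {Ω : Type*} [MeasurableSpace Ω] (μ : Measure Ω) [IsFiniteMeasure μ]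
    (p : ℝ≥0∞) [Fact (1 ≤ p)] : Lp ℝ ∞ μ →L[ℝ] Lp ℝ p μ :=
  LinearMap.mkContinuous
    { toFun := fun f => ⟨f.1, Lp.antitone le_top f.2⟩
      map_add' := fun _ _ => rfl
      map_smul' := fun _ _ => rfl }
    (μ.real Set.univ ^ p.toReal⁻¹) (fun f => by
      have h := eLpNorm_le_eLpNorm_mul_rpow_measure_univ (p := p) (q := ∞) (μ := μ) le_top
        (Lp.aestronglyMeasurable f)
      have hf : eLpNorm f ∞ μ ≠ ∞ := Lp.eLpNorm_ne_top f
      have he : (0 : ℝ) ≤ 1 / p.toReal - 1 / (∞ : ℝ≥0∞).toReal := by simp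
      have h' := ENNReal.toReal_mono
        (ENNReal.mul_ne_top hf (ENNReal.rpow_ne_top_of_nonneg he (measure_ne_top μ _))) h
      rw [ENNReal.toReal_mul, ← ENNReal.toReal_rpow, mul_comm] at h'
      simpa [Lp.norm_def, Measure.real] using h')

/-- `(A, b, l)` is a strongly Lipschitz `p`-nuclear factorization `T = A ∘ M_l ∘ b`. -/
def IsSLNuclearFactorization {X : Type u} {E : Type v} [MetricSpace X] (x₀ : X)
    [NormedAddCommGroup E] [NormedSpace ℝ E] (p : ℝ≥0∞) [Fact (1 ≤ p)] (T : X → E)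
    (A : ellP p →L[ℝ] E) (b : X → ellP ∞) (l : ellP p) : Prop :=
  IsLip0 x₀ b ∧ ∀ x, T x = A (diagOp l (b x))

/-- Strongly Lipschitz `p`-nuclear operators. -/
def IsSLNuclear {X : Type u} {E : Type v} [MetricSpace X] (x₀ : X)
    [NormedAddCommGroup E] [NormedSpace ℝ E] (p : ℝ≥0∞) [Fact (1 ≤ p)] (T : X → E) : Prop :=
  IsLip0 x₀ T ∧ ∃ (A : ellP p →L[ℝ] E) (b : X → ellP ∞) (l : ellP p),
    IsSLNuclearFactorization x₀ p T A b l

/-- `sv_p^L(T) = inf ‖A‖ ‖M_l‖ Lip(b)`, over all strongly Lipschitz `p`-nuclear factorizations. -/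
def slNuclearNorm {X : Type u} {E : Type v} [MetricSpace X] (x₀ : X)
    [NormedAddCommGroup E] [NormedSpace ℝ E] (p : ℝ≥0∞) [Fact (1 ≤ p)] (T : X → E) : ℝ :=
  sInf {c : ℝ | ∃ (A : ellP p →L[ℝ] E) (b : X → ellP ∞) (l : ellP p),
    IsSLNuclearFactorization x₀ p T A b l ∧ c = ‖A‖ * ‖diagOp l‖ * lipNorm b}

/-- `(A, b, μ)` is a strongly Lipschitz `p`-integral factorization
`K_E ∘ T = A ∘ I_{∞,p} ∘ b`, where `K_E : E → E**` is the canonical embedding. -/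
def IsSLIntegralFactorization {X : Type u} {E : Type v} [MetricSpace X] (x₀ : X)
    [NormedAddCommGroup E] [NormedSpace ℝ E] (p : ℝ≥0∞) [Fact (1 ≤ p)] (T : X → E)
    {Ω : Type t} [MeasurableSpace Ω] (μ : Measure Ω) [IsFiniteMeasure μ]
    (A : Lp ℝ p μ →L[ℝ] StrongDual ℝ (StrongDual ℝ E)) (b : X → Lp ℝ ∞ μ) : Prop :=
  IsLip0 x₀ b ∧
    ∀ x, NormedSpace.inclusionInDoubleDual ℝ E (T x) = A (inclLinftyLp μ p (b x))

/-- Strongly Lipschitz `p`-integral operators. -/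
def IsSLIntegral {X : Type u} {E : Type v} [MetricSpace X] (x₀ : X)
    [NormedAddCommGroup E] [NormedSpace ℝ E] (p : ℝ≥0∞) [Fact (1 ≤ p)] (T : X → E) : Prop :=
  IsLip0 x₀ T ∧ ∃ (Ω : Type t) (_ : MeasurableSpace Ω) (μ : Measure Ω) (_ : IsFiniteMeasure μ)
    (A : Lp ℝ p μ →L[ℝ] StrongDual ℝ (StrongDual ℝ E)) (b : X → Lp ℝ ∞ μ),
    IsSLIntegralFactorization x₀ p T μ A b

/-- `si_p^L(T) = inf ‖A‖ ‖I_{∞,p}‖ Lip(b)`, over all strongly Lipschitz `p`-integral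
factorizations. The factor `‖I_{∞,p}‖ = μ(Ω)^{1/p}` is `1` for a probability measure; it makes the
value invariant under `μ ↦ c μ`. -/
def slIntegralNorm {X : Type u} {E : Type v} [MetricSpace X] (x₀ : X)
    [NormedAddCommGroup E] [NormedSpace ℝ E] (p : ℝ≥0∞) [Fact (1 ≤ p)] (T : X → E) : ℝ :=
  sInf {c : ℝ | ∃ (Ω : Type t) (_ : MeasurableSpace Ω) (μ : Measure Ω) (_ : IsFiniteMeasure μ)
    (A : Lp ℝ p μ →L[ℝ] StrongDual ℝ (StrongDual ℝ E)) (b : X → Lp ℝ ∞ μ),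
    IsSLIntegralFactorization x₀ p T μ A b ∧ c = ‖A‖ * ‖inclLinftyLp μ p‖ * lipNorm b}

end

/-!
The theorem compares diagonal operators `ℓ_∞ → ℓ_p` with compact operators after inclusions
`L_∞(μ) → L_p(μ)`; the Lipschitz map `b` only comes along, since every change is a contraction
applied after it.

*From nuclear to integral.* A sequence `l ∈ ℓ_p` is a product `α l'` with `α` a null sequence
bounded by `1` and `l' ≥ 0` in `ℓ_p` of almost the same norm (`exists_null_mul_eq`).
Multiplication by `α` is compact on `ℓ_p` (`isCompactOperator_lpMul`) and joins the compact
factor, while the diagonal operator of `l'` factors through `L_∞(μ) → L_p(μ)` for the measure on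
`ℕ` with point masses `l'_n ^ p`. This is `exists_compact_comp_integral`.

*From integral to nuclear.* The bitranspose of a compact `v : Z → E` takes values in `E`, by
Helly's lemma and compactness, so `v ∘ L = W ∘ I_{∞,p} ∘ b` for a compact `W : L_p(μ) → E` of norm
at most `‖v‖ ‖A‖` (`exists_compact_bitranspose_comp`). It remains to see that `W ∘ I_{∞,p}` is
nuclear with constant almost `‖W‖ μ(Ω)^(1/p)` (`exists_diagonal_factorization`).

For a countable measurable partition, given as the fibres of a measurable `π : Ω → ℕ`, averaging
over the fibres is a contraction of `L_p(μ)` which factors through `ℓ_p` (`fiberCoord`, then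
`fiberEmbed`); on `L_∞(μ)` the first of these maps is diagonal up to taking means
(`fiberCoord_incl_apply`). For a functional `φ` on `L_p(μ)` the signed measure `S ↦ φ(1_S)` has an
integrable density, and if the density varies by at most `ε` on each fibre, then averaging changes
`φ` by at most a constant times `ε` (`abs_sub_fiber_le`). A countable partition of this kind
exists for finitely many functionals at once (`exists_fiber_approx`), without any information on
the integrability exponent of the densities. By compactness, finitely many functionals control
`W`, so averaging along a suitable partition approximates `W` in operator norm
(`exists_fiber_norm_sub_le`). Applying this again and again to the remainder writes `W` as a
series of discretized operators whose terms after the first one are as small as desired, and the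
terms are put side by side in `ℓ_p(ℕ × ℕ)`.
-/

/-! ### Lipschitz norms and diagonal operators -/

theorem toReal_pos_of_one_le {p : ℝ≥0∞} [Fact (1 ≤ p)] (hp : p ≠ ∞) : 0 < p.toReal :=
  ENNReal.toReal_pos (zero_lt_one.trans_le (Fact.out : 1 ≤ p)).ne' hp

theorem lipNorm_nonneg {X : Type*} {E : Type*} [MetricSpace X] [NormedAddCommGroup E]
    (f : X → E) : 0 ≤ lipNorm f := by
  apply Real.sSup_nonneg
  rintro r ⟨x, y, -, rfl⟩
  positivity

theorem norm_sub_le_lipNorm_mul_dist {X : Type*} {E : Type*} [MetricSpace X]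
    [NormedAddCommGroup E] {f : X → E} {K : ℝ≥0} (hf : LipschitzWith K f) (x y : X) :
    ‖f x - f y‖ ≤ lipNorm f * dist x y := by
  by_cases hxy : x = y
  · simp [hxy]
  have hd : 0 < dist x y := dist_pos.2 hxy
  rw [← div_le_iff₀ hd]
  refine le_csSup ⟨K, ?_⟩ ⟨x, y, hxy, rfl⟩
  rintro r ⟨x, y, hxy, rfl⟩
  rw [div_le_iff₀ (dist_pos.2 hxy), ← dist_eq_norm]
  exact hf.dist_le_mul x y

theorem lipNorm_le {X : Type*} {E : Type*} [MetricSpace X] [NormedAddCommGroup E] {f : X → E}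
    {C : ℝ} (hC : 0 ≤ C) (h : ∀ x y, ‖f x - f y‖ ≤ C * dist x y) : lipNorm f ≤ C := by
  refine Real.sSup_le ?_ hC
  rintro r ⟨x, y, hxy, rfl⟩
  rw [div_le_iff₀ (dist_pos.2 hxy)]
  exact h x y

theorem IsLip0.clm_comp {X : Type*} {E F : Type*} [MetricSpace X] [NormedAddCommGroup E]
    [NormedAddCommGroup F] [NormedSpace ℝ E] [NormedSpace ℝ F] {x₀ : X} {f : X → E}
    (hf : IsLip0 x₀ f) (B : E →L[ℝ] F) : IsLip0 x₀ fun x => B (f x) := by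
  obtain ⟨h0, K, hK⟩ := hf
  exact ⟨by simp [h0], _, B.lipschitz.comp hK⟩

theorem lipNorm_clm_comp_le {X : Type*} {E F : Type*} [MetricSpace X] [NormedAddCommGroup E]
    [NormedAddCommGroup F] [NormedSpace ℝ E] [NormedSpace ℝ F] {x₀ : X} {f : X → E}
    (hf : IsLip0 x₀ f) (B : E →L[ℝ] F) (hB : ‖B‖ ≤ 1) :
    lipNorm (fun x => B (f x)) ≤ lipNorm f := by
  obtain ⟨-, K, hK⟩ := hf
  refine lipNorm_le (lipNorm_nonneg f) fun x y => ?_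
  rw [← map_sub]
  exact (B.le_of_opNorm_le hB _).trans
    (by simpa using norm_sub_le_lipNorm_mul_dist hK x y)

theorem diagOp_apply {p : ℝ≥0∞} [Fact (1 ≤ p)] (l : ellP p) (a : ellP ∞) (n : ℕ) :
    diagOp l a n = l n * a n := rfl

theorem norm_diagOp {p : ℝ≥0∞} [Fact (1 ≤ p)] (l : ellP p) : ‖diagOp l‖ = ‖l‖ := by
  refine le_antisymm (LinearMap.mkContinuous_norm_le _ (norm_nonneg l) _) ?_
  have h : diagOp l (1 : ellP ∞) = l := by
    ext n
    simp [diagOp_apply]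
  calc ‖l‖ = ‖diagOp l (1 : ellP ∞)‖ := by rw [h]
    _ ≤ ‖diagOp l‖ * ‖(1 : ellP ∞)‖ := (diagOp l).le_opNorm _
    _ = ‖diagOp l‖ := by rw [norm_one, mul_one]

/-! ### Discretization along a countable measurable partition -/

section Fiber

variable {Ω : Type*} [MeasurableSpace Ω] (μ : Measure Ω) [IsFiniteMeasure μ]
  (p : ℝ≥0∞) [Fact (1 ≤ p)] {π : Ω → ℕ}

theorem inclLinftyLp_coeFn (f : Lp ℝ ∞ μ) : (inclLinftyLp μ p f : Ω → ℝ) = f := rfl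

theorem integrable_Lp {μ : Measure Ω} [IsFiniteMeasure μ] {p : ℝ≥0∞} [Fact (1 ≤ p)]
    (f : Lp ℝ p μ) : Integrable f μ := (Lp.memLp f).integrable Fact.out

variable {μ p}

omit [IsFiniteMeasure μ] in
theorem ae_norm_le_norm_Linfty (f : Lp ℝ ∞ μ) : ∀ᵐ ω ∂μ, ‖f ω‖ ≤ ‖f‖ := by
  filter_upwards [enorm_ae_le_eLpNormEssSup f μ] with ω hω
  rw [← eLpNorm_exponent_top] at hω
  simpa [Lp.norm_def] using ENNReal.toReal_mono (Lp.eLpNorm_ne_top f) hω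

omit [IsFiniteMeasure μ] in
theorem norm_rpow_eq_integral (hp : p ≠ ∞) (f : Lp ℝ p μ) :
    ‖f‖ ^ p.toReal = ∫ ω, ‖f ω‖ ^ p.toReal ∂μ := by
  have hr := toReal_pos_of_one_le hp
  rw [Lp.norm_def, (Lp.memLp f).eLpNorm_eq_integral_rpow_norm
    (zero_lt_one.trans_le (Fact.out : 1 ≤ p)).ne' hp, ENNReal.toReal_ofReal (by positivity),
    Real.rpow_inv_rpow (integral_nonneg fun _ => by positivity) hr.ne']

/-- Hölder's inequality against the constant function `1` on `S`. -/
theorem setIntegral_norm_le (hp : p ≠ ∞) (f : Lp ℝ p μ) (S : Set Ω) :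
    ∫ ω in S, ‖f ω‖ ∂μ ≤
      (∫ ω in S, ‖f ω‖ ^ p.toReal ∂μ) ^ p.toReal⁻¹ * μ.real S ^ (1 - p.toReal⁻¹) := by
  have hr1 : (1 : ℝ) ≤ p.toReal := by
    simpa using ENNReal.toReal_mono hp (Fact.out : 1 ≤ p)
  have hf : MemLp f p (μ.restrict S) := (Lp.memLp f).restrict S
  have h := eLpNorm_le_eLpNorm_mul_rpow_measure_univ (Fact.out : 1 ≤ p) hf.1
  rw [hf.eLpNorm_eq_integral_rpow_norm (zero_lt_one.trans_le (Fact.out : 1 ≤ p)).ne' hp] at h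
  have he : (0 : ℝ) ≤ 1 / (1 : ℝ≥0∞).toReal - 1 / p.toReal := by
    simpa using inv_le_one_of_one_le₀ hr1
  have h' := ENNReal.toReal_mono (ENNReal.mul_ne_top ENNReal.ofReal_ne_top
    (ENNReal.rpow_ne_top_of_nonneg he (measure_ne_top _ _))) h
  rw [ENNReal.toReal_mul, ENNReal.toReal_ofReal (by positivity), ← ENNReal.toReal_rpow,
    eLpNorm_one_eq_lintegral_enorm, Measure.restrict_apply_univ] at h'
  rw [integral_norm_eq_lintegral_enorm hf.1]
  simpa [Measure.real] using h'

theorem integral_norm_le_norm_mul (hp : p ≠ ∞) (f : Lp ℝ p μ) :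
    ∫ ω, ‖f ω‖ ∂μ ≤ ‖f‖ * μ.real Set.univ ^ (1 - p.toReal⁻¹) := by
  have h := setIntegral_norm_le hp f Set.univ
  rwa [setIntegral_univ, setIntegral_univ, ← norm_rpow_eq_integral hp,
    Real.rpow_rpow_inv (norm_nonneg f) (toReal_pos_of_one_le hp).ne'] at h

theorem norm_setIntegral_le (hp : p ≠ ∞) (f : Lp ℝ p μ) (S : Set Ω) :
    ‖∫ ω in S, f ω ∂μ‖ ≤
      (∫ ω in S, ‖f ω‖ ^ p.toReal ∂μ) ^ p.toReal⁻¹ * μ.real S ^ (1 - p.toReal⁻¹) :=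
  (norm_integral_le_integral_norm _).trans (setIntegral_norm_le hp f S)

theorem rpow_mul_setIntegral_le (hp : p ≠ ∞) (f : Lp ℝ p μ) (S : Set Ω) :
    ‖μ.real S ^ (p.toReal⁻¹ - 1) * ∫ ω in S, f ω ∂μ‖ ^ p.toReal ≤
      ∫ ω in S, ‖f ω‖ ^ p.toReal ∂μ := by
  have hr := toReal_pos_of_one_le hp
  have h0 : 0 ≤ ∫ ω in S, ‖f ω‖ ^ p.toReal ∂μ := integral_nonneg fun _ => by positivity
  rcases (measureReal_nonneg : 0 ≤ μ.real S).eq_or_lt with hm | hm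
  · have hS : μ.restrict S = 0 :=
      Measure.restrict_eq_zero.2 ((measureReal_eq_zero_iff (measure_ne_top _ _)).1 hm.symm)
    simp [hS, hr.ne']
  · rw [norm_mul, Real.norm_of_nonneg (by positivity : 0 ≤ μ.real S ^ (p.toReal⁻¹ - 1))]
    calc _ ≤ (μ.real S ^ (p.toReal⁻¹ - 1) * ((∫ ω in S, ‖f ω‖ ^ p.toReal ∂μ) ^ p.toReal⁻¹ *
          μ.real S ^ (1 - p.toReal⁻¹))) ^ p.toReal := by
          gcongr
          exact norm_setIntegral_le hp f S
      _ = _ := by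
          rw [mul_left_comm, ← Real.rpow_add hm, sub_add_sub_cancel, sub_self, Real.rpow_zero,
            mul_one, Real.rpow_inv_rpow h0 hr.ne']

theorem measurableSet_fiber (hπ : Measurable π) (n : ℕ) : MeasurableSet (π ⁻¹' {n}) :=
  hπ (MeasurableSet.singleton n)

omit [MeasurableSpace Ω] in
theorem iUnion_fiber (π : Ω → ℕ) : ⋃ n, π ⁻¹' {n} = Set.univ := by
  ext ω
  simp

omit [IsFiniteMeasure μ] in
theorem hasSum_integral_fiber (hπ : Measurable π) {f : Ω → ℝ} (hf : Integrable f μ) :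
    HasSum (fun n => ∫ ω in π ⁻¹' {n}, f ω ∂μ) (∫ ω, f ω ∂μ) := by
  have h := hasSum_integral_iUnion (f := f) (μ := μ) (measurableSet_fiber hπ)
    (pairwise_disjoint_fiber π) hf.integrableOn
  rwa [iUnion_fiber, setIntegral_univ] at h

omit [IsFiniteMeasure μ] in
theorem integrable_norm_rpow_Lp (hp : p ≠ ∞) (f : Lp ℝ p μ) :
    Integrable (fun ω => ‖f ω‖ ^ p.toReal) μ :=
  (Lp.memLp f).integrable_norm_rpow (zero_lt_one.trans_le (Fact.out : 1 ≤ p)).ne' hp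

theorem sum_rpow_mul_setIntegral_le (hp : p ≠ ∞) (hπ : Measurable π) (f : Lp ℝ p μ)
    (s : Finset ℕ) :
    ∑ n ∈ s, ‖μ.real (π ⁻¹' {n}) ^ (p.toReal⁻¹ - 1) * ∫ ω in π ⁻¹' {n}, f ω ∂μ‖ ^ p.toReal ≤
      ‖f‖ ^ p.toReal := by
  rw [norm_rpow_eq_integral hp]
  exact (Finset.sum_le_sum fun n _ => rpow_mul_setIntegral_le hp f _).trans
    (sum_le_hasSum s (fun n _ => integral_nonneg fun _ => by positivity)
      (hasSum_integral_fiber hπ (integrable_norm_rpow_Lp hp f)))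

variable (μ p)

/-- The normalized fibre integrals `f ↦ (μ(π = n)^(1/p - 1) ∫_{π = n} f)_n` from `L_p(μ)` to `ℓ_p`.
On a null fibre the integral vanishes, whatever the value of the power. -/
noncomputable def fiberCoord (hp : p ≠ ∞) (hπ : Measurable π) : Lp ℝ p μ →L[ℝ] ellP p :=
  LinearMap.mkContinuous
    { toFun := fun f => ⟨fun n => μ.real (π ⁻¹' {n}) ^ (p.toReal⁻¹ - 1) *
        ∫ ω in π ⁻¹' {n}, f ω ∂μ, memℓp_gen' (sum_rpow_mul_setIntegral_le hp hπ f)⟩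
      map_add' := fun f g => by
        ext n
        change (_ : ℝ) * _ = (_ : ℝ) * _ + (_ : ℝ) * _
        rw [← mul_add, ← integral_add (integrable_Lp f).integrableOn
          (integrable_Lp g).integrableOn, integral_congr_ae (ae_restrict_of_ae (Lp.coeFn_add f g))]
        rfl
      map_smul' := fun c f => by
        ext n
        change (_ : ℝ) * _ = c * ((_ : ℝ) * _)
        rw [integral_congr_ae (ae_restrict_of_ae (Lp.coeFn_smul c f))]
        simp only [Pi.smul_apply, smul_eq_mul, integral_const_mul]
        ring }
    1 fun f => by
      rw [one_mul]
      exact lp.norm_le_of_forall_sum_le (toReal_pos_of_one_le hp) (norm_nonneg f)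
        (sum_rpow_mul_setIntegral_le hp hπ f)

theorem fiberCoord_apply (hp : p ≠ ∞) (hπ : Measurable π) (f : Lp ℝ p μ) (n : ℕ) :
    fiberCoord μ p hp hπ f n =
      μ.real (π ⁻¹' {n}) ^ (p.toReal⁻¹ - 1) * ∫ ω in π ⁻¹' {n}, f ω ∂μ := rfl

theorem norm_fiberCoord_le (hp : p ≠ ∞) (hπ : Measurable π) : ‖fiberCoord μ p hp hπ‖ ≤ 1 :=
  LinearMap.mkContinuous_norm_le _ zero_le_one _

variable {μ p}

/-- Change of variables along `π` for the step function with values `x_n μ(π = n)^(-1/p)`. -/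
theorem lintegral_fiberStep_le (hp : p ≠ ∞) (hπ : Measurable π) (x : ellP p) :
    ∫⁻ ω, ‖x (π ω) * μ.real (π ⁻¹' {π ω}) ^ (-p.toReal⁻¹)‖ₑ ^ p.toReal ∂μ ≤
      ENNReal.ofReal (‖x‖ ^ p.toReal) := by
  have hr := toReal_pos_of_one_le hp
  rw [← lintegral_map (f := fun n : ℕ => ‖x n * μ.real (π ⁻¹' {n}) ^ (-p.toReal⁻¹)‖ₑ ^ p.toReal)
    (measurable_of_countable _) hπ, lintegral_countable',
    lp.norm_rpow_eq_tsum hr x, ENNReal.ofReal_tsum_of_nonneg (fun n => by positivity)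
      ((lp.memℓp x).summable hr)]
  refine ENNReal.tsum_le_tsum fun n => ?_
  rw [Measure.map_apply hπ (MeasurableSet.singleton n), enorm_mul,
    ENNReal.mul_rpow_of_nonneg _ _ hr.le, mul_assoc,
    ← ofReal_norm, ENNReal.ofReal_rpow_of_nonneg (norm_nonneg _) hr.le]
  refine mul_le_of_le_one_right' ?_
  rw [← ofReal_norm, ENNReal.ofReal_rpow_of_nonneg (norm_nonneg _) hr.le,
    ← ofReal_measureReal, ← ENNReal.ofReal_mul (by positivity), ← ENNReal.ofReal_one]
  refine ENNReal.ofReal_le_ofReal ?_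
  rcases (measureReal_nonneg : 0 ≤ μ.real (π ⁻¹' {n})).eq_or_lt with hm | hm
  · simp [← hm]
  · rw [Real.norm_of_nonneg (by positivity), ← Real.rpow_mul hm.le, neg_mul,
      inv_mul_cancel₀ hr.ne', Real.rpow_neg_one, inv_mul_cancel₀ hm.ne']

theorem eLpNorm_fiberStep_le (hp : p ≠ ∞) (hπ : Measurable π) (x : ellP p) :
    eLpNorm (fun ω => x (π ω) * μ.real (π ⁻¹' {π ω}) ^ (-p.toReal⁻¹)) p μ ≤
      ENNReal.ofReal ‖x‖ := by
  have hr := toReal_pos_of_one_le hp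
  rw [eLpNorm_eq_lintegral_rpow_enorm_toReal (zero_lt_one.trans_le (Fact.out : 1 ≤ p)).ne' hp,
    one_div]
  calc _ ≤ (ENNReal.ofReal (‖x‖ ^ p.toReal)) ^ p.toReal⁻¹ := by
        gcongr
        exact lintegral_fiberStep_le hp hπ x
    _ = _ := by
        rw [← ENNReal.ofReal_rpow_of_nonneg (norm_nonneg _) hr.le, ENNReal.rpow_rpow_inv hr.ne']

theorem memLp_fiberStep (hp : p ≠ ∞) (hπ : Measurable π) (x : ellP p) :
    MemLp (fun ω => x (π ω) * μ.real (π ⁻¹' {π ω}) ^ (-p.toReal⁻¹)) p μ :=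
  ⟨((measurable_of_countable
      (fun n : ℕ => x n * μ.real (π ⁻¹' {n}) ^ (-p.toReal⁻¹))).comp hπ).aestronglyMeasurable,
    (eLpNorm_fiberStep_le hp hπ x).trans_lt ENNReal.ofReal_lt_top⟩

variable (μ p)

/-- The map from `ℓ_p` to `L_p(μ)` which sends the `n`-th unit vector to `μ(π = n)^(-1/p)` times the
indicator of the fibre `π = n`; null fibres do not matter. -/
noncomputable def fiberEmbed (hp : p ≠ ∞) (hπ : Measurable π) : ellP p →L[ℝ] Lp ℝ p μ :=
  LinearMap.mkContinuous
    { toFun := fun x => (memLp_fiberStep hp hπ x).toLp _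
      map_add' := fun x y => by
        rw [← MemLp.toLp_add]
        exact MemLp.toLp_congr _ _ (ae_of_all _ fun ω => add_mul _ _ _)
      map_smul' := fun c x => by
        rw [RingHom.id_apply, ← MemLp.toLp_const_smul]
        exact MemLp.toLp_congr _ _ (ae_of_all _ fun ω => mul_assoc _ _ _) }
    1 fun x => by
      rw [one_mul]
      change ‖(memLp_fiberStep hp hπ x).toLp _‖ ≤ _
      rw [Lp.norm_toLp]
      exact ENNReal.toReal_le_of_le_ofReal (norm_nonneg x) (eLpNorm_fiberStep_le hp hπ x)

theorem norm_fiberEmbed_le (hp : p ≠ ∞) (hπ : Measurable π) : ‖fiberEmbed μ p hp hπ‖ ≤ 1 :=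
  LinearMap.mkContinuous_norm_le _ zero_le_one _

theorem fiberEmbed_single (hp : p ≠ ∞) (hπ : Measurable π) (n : ℕ) (c : ℝ) :
    fiberEmbed μ p hp hπ (lp.single p n c) = (c * μ.real (π ⁻¹' {n}) ^ (-p.toReal⁻¹)) •
      indicatorConstLp p (measurableSet_fiber hπ n) (measure_ne_top μ _) (1 : ℝ) := by
  change (memLp_fiberStep hp hπ _).toLp _ = _
  rw [indicatorConstLp, ← MemLp.toLp_const_smul]
  refine MemLp.toLp_congr _ _ (ae_of_all _ fun ω => ?_)
  by_cases h : π ω = n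
  · subst h
    simp
  · simp [h]

theorem norm_fiberMean_apply_le (π : Ω → ℕ) (f : Lp ℝ ∞ μ) (n : ℕ) :
    ‖(μ.real (π ⁻¹' {n}))⁻¹ * ∫ ω in π ⁻¹' {n}, f ω ∂μ‖ ≤ ‖f‖ := by
  have h1 : ‖∫ ω in π ⁻¹' {n}, f ω ∂μ‖ ≤ ‖f‖ * μ.real (π ⁻¹' {n}) :=
    norm_setIntegral_le_of_norm_le_const_ae (measure_lt_top _ _)
      (ae_restrict_of_ae (ae_norm_le_norm_Linfty f))
  rw [norm_mul, norm_inv, Real.norm_of_nonneg measureReal_nonneg]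
  refine (mul_le_mul_of_nonneg_left h1 (by positivity)).trans ?_
  rw [mul_left_comm]
  exact mul_le_of_le_one_right (norm_nonneg f) inv_mul_le_one

/-- The fibre means `f ↦ (μ(π = n)⁻¹ ∫_{π = n} f)_n` from `L_∞(μ)` to `ℓ_∞`. -/
noncomputable def fiberMean (π : Ω → ℕ) : Lp ℝ ∞ μ →L[ℝ] ellP ∞ :=
  LinearMap.mkContinuous
    { toFun := fun f => ⟨fun n => (μ.real (π ⁻¹' {n}))⁻¹ * ∫ ω in π ⁻¹' {n}, f ω ∂μ,
        memℓp_infty ⟨‖f‖, by rintro _ ⟨n, rfl⟩; exact norm_fiberMean_apply_le μ π f n⟩⟩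
      map_add' := fun f g => by
        ext n
        change (_ : ℝ) * _ = (_ : ℝ) * _ + (_ : ℝ) * _
        rw [← mul_add, ← integral_add (integrable_Lp f).integrableOn
          (integrable_Lp g).integrableOn, integral_congr_ae (ae_restrict_of_ae (Lp.coeFn_add f g))]
        rfl
      map_smul' := fun c f => by
        ext n
        change (_ : ℝ) * _ = c * ((_ : ℝ) * _)
        rw [integral_congr_ae (ae_restrict_of_ae (Lp.coeFn_smul c f))]
        simp only [Pi.smul_apply, smul_eq_mul, integral_const_mul]
        ring }
    1 fun f => by
      rw [one_mul]
      exact lp.norm_le_of_forall_le (norm_nonneg f) (norm_fiberMean_apply_le μ π f)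

theorem fiberMean_apply (π : Ω → ℕ) (f : Lp ℝ ∞ μ) (n : ℕ) :
    fiberMean μ π f n = (μ.real (π ⁻¹' {n}))⁻¹ * ∫ ω in π ⁻¹' {n}, f ω ∂μ := rfl

theorem norm_fiberMean_le (π : Ω → ℕ) : ‖fiberMean μ π‖ ≤ 1 :=
  LinearMap.mkContinuous_norm_le _ zero_le_one _

/-- On bounded functions, `fiberCoord` is the mean over each fibre followed by the diagonal
operator with weights `μ(π = n)^(1/p)`. -/
theorem fiberCoord_incl_apply (hp : p ≠ ∞) (hπ : Measurable π) (f : Lp ℝ ∞ μ) (n : ℕ) :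
    fiberCoord μ p hp hπ (inclLinftyLp μ p f) n =
      μ.real (π ⁻¹' {n}) ^ p.toReal⁻¹ * fiberMean μ π f n := by
  rw [fiberCoord_apply, fiberMean_apply, inclLinftyLp_coeFn]
  rcases (measureReal_nonneg : 0 ≤ μ.real (π ⁻¹' {n})).eq_or_lt with hm | hm
  · have hS : μ.restrict (π ⁻¹' {n}) = 0 :=
      Measure.restrict_eq_zero.2 ((measureReal_eq_zero_iff (measure_ne_top _ _)).1 hm.symm)
    simp [hS]
  · rw [Real.rpow_sub_one hm.ne']
    ring

theorem hasSum_measureReal_fiber_rpow (hp : p ≠ ∞) (hπ : Measurable π) :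
    HasSum (fun n => ‖μ.real (π ⁻¹' {n}) ^ p.toReal⁻¹‖ ^ p.toReal) (μ.real Set.univ) := by
  have hr := toReal_pos_of_one_le hp
  have h := hasSum_integral_fiber (μ := μ) (f := fun _ => (1 : ℝ)) hπ (integrable_const _)
  have h1 : ∀ n, ‖μ.real (π ⁻¹' {n}) ^ p.toReal⁻¹‖ ^ p.toReal = μ.real (π ⁻¹' {n}) := fun n => by
    rw [Real.norm_of_nonneg (by positivity), Real.rpow_inv_rpow measureReal_nonneg hr.ne']
  simp only [h1]
  simpa using h

theorem rpow_measureReal_univ_le_norm_incl (hp : p ≠ ∞) :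
    μ.real Set.univ ^ p.toReal⁻¹ ≤ ‖inclLinftyLp μ p‖ := by
  have hr := toReal_pos_of_one_le hp
  rcases eq_or_ne μ 0 with rfl | h0
  · simp [hr.ne']
  have : NeZero μ := ⟨h0⟩
  have hp0 : p ≠ 0 := (zero_lt_one.trans_le (Fact.out : 1 ≤ p)).ne'
  have h := (inclLinftyLp μ p).le_opNorm (Lp.const ∞ μ (1 : ℝ))
  have h1 : inclLinftyLp μ p (Lp.const ∞ μ (1 : ℝ)) = Lp.const p μ (1 : ℝ) := rfl
  rw [h1, Lp.norm_const (μ := μ) (c := (1 : ℝ)) (hp_zero := hp0),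
    Lp.norm_const (μ := μ) (c := (1 : ℝ)) (hp_zero := ENNReal.top_ne_zero)] at h
  simpa using h

theorem norm_inclLinftyLp_le : ‖inclLinftyLp μ p‖ ≤ μ.real Set.univ ^ p.toReal⁻¹ :=
  LinearMap.mkContinuous_norm_le _ (by positivity) _

end Fiber

/-! ### Functionals on `L_p` are almost determined by fibre means -/

section Discretization

variable {Ω : Type*} [MeasurableSpace Ω] {μ : Measure Ω} [IsFiniteMeasure μ]
  {p : ℝ≥0∞} [Fact (1 ≤ p)] {π : Ω → ℕ}

/-- The indicator function of a measurable set, as an element of `L_p(μ)`. -/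
noncomputable abbrev indLp (μ : Measure Ω) [IsFiniteMeasure μ] (p : ℝ≥0∞) {S : Set Ω}
    (hS : MeasurableSet S) : Lp ℝ p μ :=
  indicatorConstLp p hS (measure_ne_top μ S) (1 : ℝ)

omit [Fact (1 ≤ p)] in
theorem sum_indLp {f : ℕ → Set Ω} (hf : ∀ i, MeasurableSet (f i))
    (hd : Pairwise (Function.onFun Disjoint f)) (s : Finset ℕ) :
    ∑ i ∈ s, indLp μ p (hf i) = indLp μ p (s.measurableSet_biUnion fun i _ => hf i) := by
  classical
  induction s using Finset.induction_on with
  | empty => simp [indLp]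
  | insert a s ha ih =>
    rw [Finset.sum_insert ha, ih]
    have hdis : Disjoint (f a) (⋃ i ∈ s, f i) := by
      rw [Set.disjoint_iUnion₂_right]
      intro i hi
      exact hd fun h => ha (h ▸ hi)
    have h := indicatorConstLp_disjoint_union (p := p) (μ := μ) (hf a)
      (s.measurableSet_biUnion fun i _ => hf i) (measure_ne_top μ _) (measure_ne_top μ _) hdis
      (1 : ℝ)
    rw [indLp, indLp, ← h]
    congr 1
    simp

omit [Fact (1 ≤ p)] in
theorem indLp_congr {S S' : Set Ω} (h : S = S') (hS : MeasurableSet S) (hS' : MeasurableSet S') :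
    indLp μ p hS = indLp μ p hS' := by
  subst h
  rfl

theorem hasSum_indLp (hp : p ≠ ∞) {f : ℕ → Set Ω} (hf : ∀ i, MeasurableSet (f i))
    (hd : Pairwise (Function.onFun Disjoint f)) :
    HasSum (fun i => indLp μ p (hf i)) (indLp μ p (MeasurableSet.iUnion hf)) := by
  unfold HasSum
  simp only [sum_indLp hf hd]
  refine tendsto_indicatorConstLp_set hp ?_
  have hsum : ∑' i, μ (f i) ≠ ∞ := by
    rw [← measure_iUnion hd hf]
    exact measure_ne_top _ _
  refine tendsto_of_tendsto_of_tendsto_of_le_of_le tendsto_const_nhds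
    (ENNReal.tendsto_tsum_compl_atTop_zero hsum) (fun _ => zero_le) fun s => ?_
  refine (measure_mono ?_).trans (measure_iUnion_le _)
  rintro ω (⟨h1, h2⟩ | ⟨h1, h2⟩)
  · exact absurd (Set.iUnion₂_subset_iUnion _ _ h1) h2
  · obtain ⟨i, hi⟩ := Set.mem_iUnion.1 h1
    exact Set.mem_iUnion.2 ⟨⟨i, fun h => h2 (Set.mem_biUnion h hi)⟩, hi⟩

open Classical in
/-- The signed measure `S ↦ φ(1_S)` of a functional `φ` on `L_p(μ)`. -/
noncomputable def functionalMeasure (hp : p ≠ ∞) (φ : StrongDual ℝ (Lp ℝ p μ)) :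
    SignedMeasure Ω where
  measureOf' S := if hS : MeasurableSet S then φ (indLp μ p hS) else 0
  empty' := by simp [indLp]
  not_measurable' S hS := dif_neg hS
  m_iUnion' f hf hd := by
    simp only [hf, MeasurableSet.iUnion hf, dif_pos]
    exact (hasSum_indLp hp hf hd).mapL φ

theorem functionalMeasure_apply (hp : p ≠ ∞) (φ : StrongDual ℝ (Lp ℝ p μ)) {S : Set Ω}
    (hS : MeasurableSet S) : functionalMeasure hp φ S = φ (indLp μ p hS) :=
  dif_pos hS

/-- Radon–Nikodym for functionals on `L_p(μ)`, tested on indicator functions only. -/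
theorem exists_density (hp : p ≠ ∞) (φ : StrongDual ℝ (Lp ℝ p μ)) :
    ∃ g : Ω → ℝ, Measurable g ∧ Integrable g μ ∧
      ∀ {S : Set Ω} (hS : MeasurableSet S), φ (indLp μ p hS) = ∫ ω in S, g ω ∂μ := by
  have hac : (functionalMeasure hp φ) ≪ᵥ μ.toENNRealVectorMeasure := by
    refine VectorMeasure.AbsolutelyContinuous.mk fun S hS h => ?_
    rw [Measure.toENNRealVectorMeasure_apply_measurable hS] at h
    rw [functionalMeasure_apply hp φ hS]
    have h0 : indLp μ p hS = 0 := by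
      rw [← norm_eq_zero, norm_indicatorConstLp (zero_lt_one.trans_le (Fact.out : 1 ≤ p)).ne' hp]
      simp [measureReal_def, h, (toReal_pos_of_one_le hp).ne']
    rw [h0, map_zero]
  refine ⟨(functionalMeasure hp φ).rnDeriv μ, SignedMeasure.measurable_rnDeriv _ _,
    SignedMeasure.integrable_rnDeriv _ _, fun {S} hS => ?_⟩
  rw [← withDensityᵥ_apply (SignedMeasure.integrable_rnDeriv _ _) hS,
    SignedMeasure.withDensityᵥ_rnDeriv_eq _ _ hac, functionalMeasure_apply hp φ hS]

/-- Functionals of a finite family have densities which are constant up to `ε` on the fibres of a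
single countable partition: round the densities down to multiples of `ε`. -/
theorem exists_fiber_approx (hp : p ≠ ∞) {ι : Type*} [Finite ι] (φ : ι → StrongDual ℝ (Lp ℝ p μ))
    {ε : ℝ} (hε : 0 < ε) :
    ∃ π : Ω → ℕ, Measurable π ∧ ∀ i n, ∃ c : ℝ, ∀ {S : Set Ω} (hS : MeasurableSet S),
      S ⊆ π ⁻¹' {n} → |φ i (indLp μ p hS) - c * μ.real S| ≤ ε * μ.real S := by
  choose g hgm hgi hg using fun i => exists_density hp (φ i)
  obtain ⟨e, he⟩ := exists_injective_nat (ι → ℤ)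
  refine ⟨fun ω => e fun i => ⌊g i ω / ε⌋, ?_, fun i n => ?_⟩
  · exact (measurable_of_countable e).comp
      (measurable_pi_lambda _ fun i => ((hgm i).div_const ε).floor)
  by_cases hne : ∃ ω₀, e (fun i => ⌊g i ω₀ / ε⌋) = n
  · obtain ⟨ω₀, rfl⟩ := hne
    refine ⟨ε * ⌊g i ω₀ / ε⌋, fun {S} hS hsub => ?_⟩
    have hpt : ∀ ω ∈ S, ‖g i ω - ε * ⌊g i ω₀ / ε⌋‖ ≤ ε := fun ω hω => by
      have h1 : ⌊g i ω / ε⌋ = ⌊g i ω₀ / ε⌋ := congrFun (he (hsub hω)) i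
      rw [← h1]
      have h2 : (⌊g i ω / ε⌋ : ℝ) * ε ≤ g i ω := (le_div_iff₀ hε).1 (Int.floor_le _)
      have h3 : g i ω < (⌊g i ω / ε⌋ + 1) * ε := (div_lt_iff₀ hε).1 (Int.lt_floor_add_one _)
      rw [Real.norm_eq_abs, abs_le]
      constructor <;> nlinarith
    have h := norm_setIntegral_le_of_norm_le_const (measure_lt_top μ S) hpt
    rw [integral_sub (hgi i).integrableOn (integrable_const _), setIntegral_const, ← hg i hS,
      smul_eq_mul, mul_comm (μ.real S)] at h
    exact h
  · refine ⟨0, fun {S} hS hsub => ?_⟩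
    have h0 : S = ∅ := Set.eq_empty_of_forall_notMem fun ω hω => hne ⟨ω, hsub hω⟩
    subst h0
    simp [indLp]

theorem continuous_integral_norm (hp : p ≠ ∞) :
    Continuous fun f : Lp ℝ p μ => ∫ ω, ‖f ω‖ ∂μ := by
  refine (LipschitzWith.of_le_add_mul (⟨μ.real Set.univ ^ (1 - p.toReal⁻¹), by positivity⟩ : ℝ≥0)
    fun f g => ?_).continuous
  have h : ∫ ω, ‖f ω‖ ∂μ ≤ ∫ ω, ‖g ω‖ + ‖(f - g) ω‖ ∂μ := by
    refine integral_mono_ae (integrable_Lp f).norm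
      ((integrable_Lp g).norm.add (integrable_Lp _).norm) ?_
    filter_upwards [Lp.coeFn_sub f g] with ω hω
    rw [hω, Pi.sub_apply]
    exact norm_le_norm_add_norm_sub' _ _
  rw [integral_add (integrable_Lp g).norm (integrable_Lp _).norm] at h
  refine h.trans ?_
  rw [dist_eq_norm]
  have h2 := integral_norm_le_norm_mul hp (f - g)
  rw [mul_comm] at h2
  exact add_le_add_right h2 _

theorem fiberCoord_mul_rpow (hp : p ≠ ∞) (hπ : Measurable π) (f : Lp ℝ p μ) (n : ℕ) :
    fiberCoord μ p hp hπ f n * μ.real (π ⁻¹' {n}) ^ (-p.toReal⁻¹) =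
      (μ.real (π ⁻¹' {n}))⁻¹ * ∫ ω in π ⁻¹' {n}, f ω ∂μ := by
  rw [fiberCoord_apply]
  rcases (measureReal_nonneg : 0 ≤ μ.real (π ⁻¹' {n})).eq_or_lt with hm | hm
  · have hS : μ.restrict (π ⁻¹' {n}) = 0 :=
      Measure.restrict_eq_zero.2 ((measureReal_eq_zero_iff (measure_ne_top _ _)).1 hm.symm)
    simp [hS]
  · have e : p.toReal⁻¹ - 1 + -p.toReal⁻¹ = -1 := by ring
    rw [mul_right_comm, ← Real.rpow_add hm, e, Real.rpow_neg_one]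

theorem hasSum_functional_fiberEmbed (hp : p ≠ ∞) (hπ : Measurable π)
    (φ : StrongDual ℝ (Lp ℝ p μ)) (f : Lp ℝ p μ) :
    HasSum (fun n => (μ.real (π ⁻¹' {n}))⁻¹ * (∫ ω in π ⁻¹' {n}, f ω ∂μ) *
      φ (indLp μ p (measurableSet_fiber hπ n)))
      (φ (fiberEmbed μ p hp hπ (fiberCoord μ p hp hπ f))) := by
  have h := (lp.hasSum_single hp (fiberCoord μ p hp hπ f)).mapL (φ.comp (fiberEmbed μ p hp hπ))
  simp only [ContinuousLinearMap.comp_apply, fiberEmbed_single, map_smul, smul_eq_mul,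
    fiberCoord_mul_rpow] at h
  exact h

theorem abs_sub_fiber_indLp_le (hp : p ≠ ∞) (hπ : Measurable π) (φ : StrongDual ℝ (Lp ℝ p μ))
    {ε : ℝ} (h : ∀ n, ∃ c : ℝ, ∀ {S : Set Ω} (hS : MeasurableSet S),
      S ⊆ π ⁻¹' {n} → |φ (indLp μ p hS) - c * μ.real S| ≤ ε * μ.real S)
    {S : Set Ω} (hS : MeasurableSet S) :
    |φ (indLp μ p hS) - φ (fiberEmbed μ p hp hπ (fiberCoord μ p hp hπ (indLp μ p hS)))| ≤
      2 * ε * μ.real S := by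
  have hm := fun n => hS.inter (measurableSet_fiber hπ n)
  have hd : Pairwise (Function.onFun Disjoint fun n => S ∩ π ⁻¹' {n}) := fun i j hij =>
    (pairwise_disjoint_fiber π hij).mono Set.inter_subset_right Set.inter_subset_right
  have hU : ⋃ n, S ∩ π ⁻¹' {n} = S := by rw [← Set.inter_iUnion, iUnion_fiber, Set.inter_univ]
  have h1 : HasSum (fun n => φ (indLp μ p (hm n))) (φ (indLp μ p hS)) := by
    rw [indLp_congr hU.symm hS (MeasurableSet.iUnion hm)]
    exact (hasSum_indLp (μ := μ) hp hm hd).mapL φ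
  have hint : ∀ n, ∫ ω in π ⁻¹' {n}, indLp μ p hS ω ∂μ = μ.real (S ∩ π ⁻¹' {n}) := fun n => by
    rw [setIntegral_indicatorConstLp (measurableSet_fiber hπ n), smul_eq_mul, mul_one]
  have h2 := hasSum_functional_fiberEmbed hp hπ φ (indLp μ p hS)
  simp only [hint] at h2
  have h3 : HasSum (fun n => 2 * ε * μ.real (S ∩ π ⁻¹' {n})) (2 * ε * μ.real S) := by
    refine HasSum.mul_left _ ?_
    have h4 := hasSum_integral_fiber (μ := μ) hπ (integrable_Lp (indLp μ p hS))
    simp only [hint] at h4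
    rwa [← setIntegral_univ, setIntegral_indicatorConstLp MeasurableSet.univ, smul_eq_mul, mul_one,
      Set.inter_univ] at h4
  refine (h1.sub h2).norm_le_of_bounded h3 fun n => ?_
  obtain ⟨c, hc⟩ := h n
  have e1 := hc (hm n) Set.inter_subset_right
  have e2 := hc (measurableSet_fiber hπ n) subset_rfl
  set a := μ.real (S ∩ π ⁻¹' {n})
  set m := μ.real (π ⁻¹' {n})
  have ha0 : 0 ≤ a := measureReal_nonneg
  have ham : a ≤ m := measureReal_mono Set.inter_subset_right
  rcases (ha0.trans ham).eq_or_lt with h0 | h0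
  · have ha : a = 0 := le_antisymm (h0 ▸ ham) ha0
    simpa [ha] using e1
  · have e3 : φ (indLp μ p (hm n)) - m⁻¹ * a * φ (indLp μ p (measurableSet_fiber hπ n)) =
        (φ (indLp μ p (hm n)) - c * a) -
          m⁻¹ * a * (φ (indLp μ p (measurableSet_fiber hπ n)) - c * m) := by
      field_simp
      ring
    rw [Real.norm_eq_abs, e3]
    refine (abs_sub _ _).trans ?_
    rw [abs_mul, abs_of_nonneg (by positivity : 0 ≤ m⁻¹ * a)]
    calc _ ≤ ε * a + m⁻¹ * a * (ε * m) := by gcongr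
      _ = 2 * ε * a := by field_simp; ring

/-- If the density of `φ` is constant up to `ε` on the fibres, averaging over the fibres changes `φ`
by at most `2 ε` in the `L_1` norm. -/
theorem abs_sub_fiber_le (hp : p ≠ ∞) (hπ : Measurable π) (φ : StrongDual ℝ (Lp ℝ p μ))
    {ε : ℝ} (h : ∀ n, ∃ c : ℝ, ∀ {S : Set Ω} (hS : MeasurableSet S),
      S ⊆ π ⁻¹' {n} → |φ (indLp μ p hS) - c * μ.real S| ≤ ε * μ.real S) (f : Lp ℝ p μ) :
    |φ f - φ (fiberEmbed μ p hp hπ (fiberCoord μ p hp hπ f))| ≤ 2 * ε * ∫ ω, ‖f ω‖ ∂μ := by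
  induction f using Lp.induction (hp_ne_top := hp) with
  | indicatorConst c hS hμS =>
    rename_i S
    have e : ((Lp.simpleFunc.indicatorConst p hS hμS.ne c : Lp.simpleFunc ℝ p μ) : Lp ℝ p μ) =
        c • indLp μ p hS := by
      rw [Lp.simpleFunc.coe_indicatorConst, indLp, indicatorConstLp, indicatorConstLp,
        ← MemLp.toLp_const_smul]
      refine MemLp.toLp_congr _ _ (ae_of_all _ fun ω => ?_)
      by_cases hω : ω ∈ S <;> simp [hω]
    have e2 : ∫ ω, ‖(c • indLp μ p hS : Lp ℝ p μ) ω‖ ∂μ = |c| * μ.real S := by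
      have e3 : ∀ᵐ ω ∂μ, ‖(c • indLp μ p hS : Lp ℝ p μ) ω‖ = |c| * indLp μ p hS ω := by
        filter_upwards [Lp.coeFn_smul c (indLp μ p hS),
          indicatorConstLp_coeFn (p := p) (hs := hS) (hμs := measure_ne_top μ S) (c := (1 : ℝ))]
          with ω h1 h2
        rw [h1, Pi.smul_apply, norm_smul, h2, Real.norm_eq_abs, Real.norm_of_nonneg]
        exact Set.indicator_nonneg (fun _ _ => zero_le_one) _
      rw [integral_congr_ae e3, integral_const_mul, ← setIntegral_univ,
        setIntegral_indicatorConstLp MeasurableSet.univ, smul_eq_mul, mul_one, Set.inter_univ]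
    rw [e, e2]
    simp only [map_smul, smul_eq_mul]
    rw [← mul_sub, abs_mul, mul_left_comm]
    exact mul_le_mul_of_nonneg_left (abs_sub_fiber_indLp_le hp hπ φ h hS) (abs_nonneg c)
  | add hf hg hd ihf ihg =>
    rename_i f g
    have e : ∫ ω, ‖(hf.toLp f + hg.toLp g : Lp ℝ p μ) ω‖ ∂μ =
        (∫ ω, ‖hf.toLp f ω‖ ∂μ) + ∫ ω, ‖hg.toLp g ω‖ ∂μ := by
      rw [← integral_add (integrable_Lp _).norm (integrable_Lp _).norm]
      refine integral_congr_ae ?_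
      filter_upwards [Lp.coeFn_add (hf.toLp f) (hg.toLp g), hf.coeFn_toLp, hg.coeFn_toLp]
        with ω h1 h2 h3
      rw [h1, Pi.add_apply, h2, h3]
      by_cases hω : f ω = 0
      · simp [hω]
      · have : g ω = 0 := by
          by_contra hgω
          exact Set.disjoint_left.1 hd hω hgω
        simp [this]
    rw [e, mul_add]
    simp only [map_add]
    rw [add_sub_add_comm]
    exact (abs_add_le _ _).trans (add_le_add ihf ihg)
  | isClosed =>
    refine isClosed_le ?_ (continuous_const.mul (continuous_integral_norm hp))
    fun_prop

end Discretization

/-! ### Compact operators on `L_p` are approximated by discretization -/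

/-- On a compact set, the functionals of norm at most `1` are approximated uniformly by finitely
many of them: compare values on a finite net of the set. -/
theorem exists_finite_functional_net {E : Type*} [NormedAddCommGroup E] [NormedSpace ℝ E]
    {K : Set E} (hK : IsCompact K) {ε : ℝ} (hε : 0 < ε) :
    ∃ t : Set (StrongDual ℝ E), t.Finite ∧ ∀ y : StrongDual ℝ E, ‖y‖ ≤ 1 →
      ∃ z ∈ t, ∀ x ∈ K, |y x - z x| ≤ ε := by
  obtain ⟨F, -, hF, hKF⟩ := hK.finite_cover_balls (e := ε / 3) (by positivity)
  have := hF.to_subtype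
  have := Fintype.ofFinite F
  let Φ : StrongDual ℝ E → (F → ℝ) := fun y x => y x
  have hb : TotallyBounded (Φ '' Metric.closedBall 0 1) := by
    refine TotallyBounded.subset subset_closure
      (Bornology.IsBounded.isCompact_closure ?_).totallyBounded
    refine (Bornology.forall_isBounded_image_eval_iff).1 fun x => ?_
    rw [isBounded_iff_forall_norm_le]
    refine ⟨‖(x : E)‖, ?_⟩
    rintro _ ⟨_, ⟨y, hy, rfl⟩, rfl⟩
    rw [mem_closedBall_zero_iff] at hy
    simpa using y.le_of_opNorm_le hy x
  obtain ⟨s, hs, hsf, hcov⟩ := Metric.finite_approx_of_totallyBounded hb (ε / 3) (by positivity)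
  have hs' : ∀ c ∈ s, ∃ y ∈ Metric.closedBall (0 : StrongDual ℝ E) 1, Φ y = c :=
    fun c hc => hs hc
  choose! ψ hψb hψe using hs'
  refine ⟨ψ '' s, hsf.image ψ, fun y hy => ?_⟩
  obtain ⟨c, hc, hyc⟩ := Set.mem_iUnion₂.1 (hcov ⟨y, by simpa using hy, rfl⟩)
  refine ⟨ψ c, Set.mem_image_of_mem ψ hc, fun x hx => ?_⟩
  obtain ⟨x', hx', hxx'⟩ := Set.mem_iUnion₂.1 (hKF hx)
  rw [Metric.mem_ball, dist_eq_norm] at hxx'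
  have h1 : |y (x - x')| ≤ ε / 3 := by
    simpa using (y.le_of_opNorm_le hy (x - x')).trans (by linarith)
  have h2 : |ψ c (x - x')| ≤ ε / 3 := by
    simpa using ((ψ c).le_of_opNorm_le (by simpa using hψb c hc) (x - x')).trans (by linarith)
  have h3 : |y x' - ψ c x'| < ε / 3 := by
    rw [← hψe c hc, Metric.mem_ball, dist_pi_lt_iff (by positivity)] at hyc
    exact hyc ⟨x', hx'⟩
  have e : y x - ψ c x = y (x - x') - ψ c (x - x') + (y x' - ψ c x') := by
    simp only [map_sub]
    ring
  rw [e]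
  calc _ ≤ |y (x - x')| + |ψ c (x - x')| + |y x' - ψ c x'| :=
        (abs_add_le _ _).trans (add_le_add_left (abs_sub _ _) _)
    _ ≤ ε := by linarith

/-- A compact operator on `L_p(μ)` is approximated in norm by its composition with the averaging
operator of a countable partition. -/
theorem exists_fiber_norm_sub_le {Ω : Type*} [MeasurableSpace Ω] {μ : Measure Ω}
    [IsFiniteMeasure μ] {p : ℝ≥0∞} [Fact (1 ≤ p)] (hp : p ≠ ∞) {E : Type*} [NormedAddCommGroup E]
    [NormedSpace ℝ E] (W : Lp ℝ p μ →L[ℝ] E) (hW : IsCompactOperator W) {ε : ℝ} (hε : 0 < ε) :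
    ∃ (π : Ω → ℕ) (hπ : Measurable π),
      ‖W - W.comp ((fiberEmbed μ p hp hπ).comp (fiberCoord μ p hp hπ))‖ ≤ ε := by
  obtain ⟨K, hK, hWK⟩ := hW.image_closedBall_subset_compact (f := W.toLinearMap) 1
  obtain ⟨t, htf, ht⟩ := exists_finite_functional_net hK (ε := ε / 4) (by positivity)
  have := htf.to_subtype
  set C : ℝ := μ.real Set.univ ^ (1 - p.toReal⁻¹)
  have hC : 0 ≤ C := by positivity
  -- the factor `C` bounds the `L_1` norm by the `L_p` norm
  obtain ⟨π, hπ, h⟩ := exists_fiber_approx (μ := μ) hp (fun z : t => (z : StrongDual ℝ E).comp W)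
    (ε := ε / (4 * (C + 1))) (by positivity)
  refine ⟨π, hπ, ?_⟩
  set P := (fiberEmbed μ p hp hπ).comp (fiberCoord μ p hp hπ) with hP
  have hPn : ‖P‖ ≤ 1 := (ContinuousLinearMap.opNorm_comp_le _ _).trans
    (mul_le_one₀ (norm_fiberEmbed_le μ p hp hπ) (norm_nonneg _) (norm_fiberCoord_le μ p hp hπ))
  refine ContinuousLinearMap.opNorm_le_of_unit_norm hε.le fun f hf => ?_
  obtain ⟨y, hy, hyf⟩ := exists_dual_vector'' ℝ ((W - W.comp P) f)
  obtain ⟨z, hz, hyz⟩ := ht y hy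
  have hWf : W f ∈ K := hWK ⟨f, by simp [hf], rfl⟩
  have hWPf : W (P f) ∈ K := hWK ⟨P f, by
    simpa [hf] using P.le_of_opNorm_le hPn f, rfl⟩
  have h1 := hyz _ hWf
  have h2 := hyz _ hWPf
  have h3 : |z (W f) - z (W (P f))| ≤ ε / 2 := by
    refine (abs_sub_fiber_le hp hπ (z.comp W) (h ⟨z, hz⟩) f).trans ?_
    have h4 := integral_norm_le_norm_mul hp f
    rw [hf, one_mul] at h4
    calc _ ≤ 2 * (ε / (4 * (C + 1))) * (C + 1) := by
          gcongr
          linarith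
      _ = ε / 2 := by field_simp; ring
  have e : ‖(W - W.comp P) f‖ = y (W f) - y (W (P f)) := by
    rw [← map_sub]
    exact hyf.symm
  rw [e]
  rw [abs_le] at h1 h2 h3
  linarith [h1.2, h2.1, h3.2]

/-! ### Nuclear factorization of compact operators restricted to `L_∞` -/

theorem sum_rpow_reindex_le {p : ℝ≥0∞} [Fact (1 ≤ p)] (hp : p ≠ ∞) {e : ℕ → ℕ}
    (he : Function.Injective e) (x : ellP p) (s : Finset ℕ) :
    ∑ n ∈ s, ‖x (e n)‖ ^ p.toReal ≤ ‖x‖ ^ p.toReal := by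
  have h := lp.sum_rpow_le_norm_rpow (toReal_pos_of_one_le hp) x (s.map ⟨e, he⟩)
  rwa [Finset.sum_map] at h

/-- Composition of a `p`-summable sequence with an injective map of the index set. -/
noncomputable def lpReindex (p : ℝ≥0∞) [Fact (1 ≤ p)] (hp : p ≠ ∞) (e : ℕ → ℕ)
    (he : Function.Injective e) : ellP p →L[ℝ] ellP p :=
  LinearMap.mkContinuous
    { toFun := fun x => ⟨fun n => x (e n), memℓp_gen' (sum_rpow_reindex_le hp he x)⟩
      map_add' := fun x y => rfl
      map_smul' := fun c x => rfl }
    1 fun x => by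
      rw [one_mul]
      exact lp.norm_le_of_forall_sum_le (toReal_pos_of_one_le hp) (norm_nonneg x)
        (sum_rpow_reindex_le hp he x)

theorem lpReindex_apply {p : ℝ≥0∞} [Fact (1 ≤ p)] (hp : p ≠ ∞) {e : ℕ → ℕ}
    (he : Function.Injective e) (x : ellP p) (n : ℕ) : lpReindex p hp e he x n = x (e n) := rfl

theorem norm_lpReindex_le {p : ℝ≥0∞} [Fact (1 ≤ p)] (hp : p ≠ ∞) {e : ℕ → ℕ}
    (he : Function.Injective e) : ‖lpReindex p hp e he‖ ≤ 1 :=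
  LinearMap.mkContinuous_norm_le _ zero_le_one _

theorem pair_left_injective (k : ℕ) : Function.Injective (Nat.pair k) := fun a b h => by
  simpa using congrArg (fun m => (Nat.unpair m).2) h

theorem norm_glue_apply_le {F : Type*} [NormedAddCommGroup F] [NormedSpace ℝ F]
    (B : ℕ → F →L[ℝ] ellP ∞) (hB : ∀ k, ‖B k‖ ≤ 1) (f : F) (m : ℕ) :
    ‖B m.unpair.1 f m.unpair.2‖ ≤ ‖f‖ :=
  (lp.norm_apply_le_norm ENNReal.top_ne_zero _ _).trans
    (by simpa using (B m.unpair.1).le_of_opNorm_le (hB _) f)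

/-- A sequence of contractions into `ℓ_∞`, combined into one contraction into `ℓ_∞(ℕ × ℕ)`, where
`ℕ × ℕ` is identified with `ℕ` by the pairing function. -/
noncomputable def linftyGlue {F : Type*} [NormedAddCommGroup F] [NormedSpace ℝ F]
    (B : ℕ → F →L[ℝ] ellP ∞) (hB : ∀ k, ‖B k‖ ≤ 1) : F →L[ℝ] ellP ∞ :=
  LinearMap.mkContinuous
    { toFun := fun f => ⟨fun m => B m.unpair.1 f m.unpair.2,
        memℓp_infty ⟨‖f‖, by rintro _ ⟨m, rfl⟩; exact norm_glue_apply_le B hB f m⟩⟩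
      map_add' := fun f g => by
        ext m
        change B m.unpair.1 (f + g) m.unpair.2 = B m.unpair.1 f m.unpair.2 +
          B m.unpair.1 g m.unpair.2
        rw [map_add]
        rfl
      map_smul' := fun c f => by
        ext m
        change B m.unpair.1 (c • f) m.unpair.2 = c * B m.unpair.1 f m.unpair.2
        rw [map_smul]
        rfl }
    1 fun f => by
      rw [one_mul]
      exact lp.norm_le_of_forall_le (norm_nonneg f) (norm_glue_apply_le B hB f)

theorem linftyGlue_apply {F : Type*} [NormedAddCommGroup F] [NormedSpace ℝ F]
    (B : ℕ → F →L[ℝ] ellP ∞) (hB : ∀ k, ‖B k‖ ≤ 1) (f : F) (m : ℕ) :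
    linftyGlue B hB f m = B m.unpair.1 f m.unpair.2 := rfl

theorem norm_linftyGlue_le {F : Type*} [NormedAddCommGroup F] [NormedSpace ℝ F]
    (B : ℕ → F →L[ℝ] ellP ∞) (hB : ∀ k, ‖B k‖ ≤ 1) : ‖linftyGlue B hB‖ ≤ 1 :=
  LinearMap.mkContinuous_norm_le _ zero_le_one _

/-- The sequence `a, δ / 2, δ / 4, …`. -/
noncomputable def geomTail (a δ : ℝ) : ℕ → ℝ
  | 0 => a
  | k + 1 => δ / 2 / 2 ^ k

theorem hasSum_geomTail (a δ : ℝ) : HasSum (geomTail a δ) (a + δ) := by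
  rw [← hasSum_nat_add_iff' 1]
  simpa [geomTail] using hasSum_geometric_two' δ

theorem geomTail_one_pos {δ : ℝ} (hδ : 0 < δ) (k : ℕ) : 0 < geomTail 1 δ k := by
  cases k with
  | zero => exact one_pos
  | succ k => exact div_pos (half_pos hδ) (by positivity)

theorem geomTail_one_le_one {δ : ℝ} (hδ1 : δ ≤ 1) (k : ℕ) : geomTail 1 δ k ≤ 1 := by
  cases k with
  | zero => exact le_rfl
  | succ k =>
    change δ / 2 / 2 ^ k ≤ 1
    rw [div_le_one (by positivity)]
    have : (1 : ℝ) ≤ 2 ^ k := one_le_pow₀ one_le_two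
    linarith

section Nuclear

variable {Ω : Type*} [MeasurableSpace Ω] {μ : Measure Ω} [IsFiniteMeasure μ]
  {p : ℝ≥0∞} [Fact (1 ≤ p)] {E : Type*} [NormedAddCommGroup E] [NormedSpace ℝ E]

/-- Successive discretizations of a compact operator: the remainder left by one step is again
compact, so that it can be discretized along a new partition with a smaller remainder. -/
theorem exists_remainder_seq (hp : p ≠ ∞) (W : Lp ℝ p μ →L[ℝ] E) (hW : IsCompactOperator W)
    {ε : ℕ → ℝ} (hε : ∀ k, 0 < ε k) :
    ∃ (V : ℕ → Lp ℝ p μ →L[ℝ] E) (π : ℕ → Ω → ℕ) (hπ : ∀ k, Measurable (π k)), V 0 = W ∧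
      ∀ k, V (k + 1) = V k - (V k).comp
          ((fiberEmbed μ p hp (hπ k)).comp (fiberCoord μ p hp (hπ k))) ∧
        ‖V (k + 1)‖ ≤ ε k := by
  choose! π hπ hπε using fun (k : ℕ) (V : {V : Lp ℝ p μ →L[ℝ] E // IsCompactOperator V}) =>
    exists_fiber_norm_sub_le hp V.1 V.2 (hε k)
  let next : ℕ → {V : Lp ℝ p μ →L[ℝ] E // IsCompactOperator V} →
      {V : Lp ℝ p μ →L[ℝ] E // IsCompactOperator V} := fun k V =>
    ⟨V.1 - V.1.comp ((fiberEmbed μ p hp (hπ k V)).comp (fiberCoord μ p hp (hπ k V))),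
      V.2.sub (V.2.comp_clm _)⟩
  let U : ℕ → {V : Lp ℝ p μ →L[ℝ] E // IsCompactOperator V} := fun k =>
    Nat.rec ⟨W, hW⟩ next k
  exact ⟨fun k => (U k).1, fun k => π k (U k), fun k => hπ k (U k), rfl,
    fun k => ⟨rfl, hπε k (U k)⟩⟩

/-- The weights `t_k μ(π_k = n)^(1/p)`, as a sequence indexed by the pairs `(k, n)`. -/
theorem exists_fiberWeights (hp : p ≠ ∞) {π : ℕ → Ω → ℕ} (hπ : ∀ k, Measurable (π k)) {δ : ℝ}
    (hδ : 0 < δ) (hδ1 : δ ≤ 1) :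
    ∃ l : ellP p, ‖l‖ ≤ (1 + δ) * μ.real Set.univ ^ p.toReal⁻¹ ∧ ∀ m : ℕ,
      l m = geomTail 1 δ m.unpair.1 *
        μ.real (π m.unpair.1 ⁻¹' {m.unpair.2}) ^ p.toReal⁻¹ := by
  have hr := toReal_pos_of_one_le hp
  have hr1 : (1 : ℝ) ≤ p.toReal := by
    simpa using ENNReal.toReal_mono hp (Fact.out : 1 ≤ p)
  set M := μ.real Set.univ
  let F : ℕ × ℕ → ℝ := fun q =>
    ‖geomTail 1 δ q.1 * μ.real (π q.1 ⁻¹' {q.2}) ^ p.toReal⁻¹‖ ^ p.toReal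
  have hF0 : ∀ q, 0 ≤ F q := fun q => by positivity
  have hFk : ∀ k, HasSum (fun n => F (k, n)) (geomTail 1 δ k ^ p.toReal * M) := fun k => by
    have h := (hasSum_measureReal_fiber_rpow (μ := μ) (p := p) hp (hπ k)).mul_left
      (geomTail 1 δ k ^ p.toReal)
    have e : (fun n => F (k, n)) = fun n => geomTail 1 δ k ^ p.toReal *
        ‖μ.real (π k ⁻¹' {n}) ^ p.toReal⁻¹‖ ^ p.toReal := funext fun n => by
      change ‖geomTail 1 δ k * μ.real (π k ⁻¹' {n}) ^ p.toReal⁻¹‖ ^ p.toReal = _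
      rw [norm_mul, Real.mul_rpow (norm_nonneg _) (norm_nonneg _),
        Real.norm_of_nonneg (geomTail_one_pos hδ k).le]
    rwa [e]
  have hle : ∀ k, geomTail 1 δ k ^ p.toReal * M ≤ geomTail 1 δ k * M := fun k =>
    mul_le_mul_of_nonneg_right (Real.rpow_le_self_of_le_one (geomTail_one_pos hδ k).le
      (geomTail_one_le_one hδ1 k) hr1) measureReal_nonneg
  have hS := (hasSum_geomTail 1 δ).mul_right M
  have hs2 : Summable fun k => geomTail 1 δ k ^ p.toReal * M :=
    Summable.of_nonneg_of_le (fun k => mul_nonneg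
      (Real.rpow_nonneg (geomTail_one_pos hδ k).le _) measureReal_nonneg) hle hS.summable
  have hsum : Summable F := by
    rw [summable_prod_of_nonneg hF0]
    refine ⟨fun k => (hFk k).summable, ?_⟩
    simpa only [(hFk _).tsum_eq] using hs2
  have htsum : ∑' q, F q ≤ (1 + δ) * M := by
    rw [hsum.tsum_prod' fun k => (hFk k).summable]
    simp only [(hFk _).tsum_eq]
    rw [← hS.tsum_eq]
    exact hs2.tsum_le_tsum hle hS.summable
  have hsum' : Summable fun m : ℕ => F m.unpair :=
    (Nat.pairEquiv.symm.summable_iff (f := F)).2 hsum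
  refine ⟨⟨fun m => geomTail 1 δ m.unpair.1 *
    μ.real (π m.unpair.1 ⁻¹' {m.unpair.2}) ^ p.toReal⁻¹, memℓp_gen hsum'⟩, ?_, fun m => rfl⟩
  refine lp.norm_le_of_tsum_le hr (by positivity) ?_
  calc ∑' m : ℕ, F m.unpair = ∑' q, F q := Nat.pairEquiv.symm.tsum_eq F
    _ ≤ (1 + δ) * M := htsum
    _ ≤ (1 + δ) ^ p.toReal * M :=
        mul_le_mul_of_nonneg_right (Real.self_le_rpow_of_one_le (by linarith) hr1)
          measureReal_nonneg
    _ = _ := by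
        rw [Real.mul_rpow (by positivity) (by positivity),
          Real.rpow_inv_rpow measureReal_nonneg hr.ne']

/-- A compact operator on `L_p(μ)` becomes nuclear, with almost no loss in the constant, once it is
restricted to `L_∞(μ)`. -/
theorem exists_diagonal_factorization [CompleteSpace E] (hp : p ≠ ∞) (W : Lp ℝ p μ →L[ℝ] E)
    (hW : IsCompactOperator W) {δ : ℝ} (hδ : 0 < δ) (hδ1 : δ ≤ 1) :
    ∃ (A : ellP p →L[ℝ] E) (B : Lp ℝ ∞ μ →L[ℝ] ellP ∞) (l : ellP p),
      ‖A‖ ≤ ‖W‖ + δ ∧ ‖B‖ ≤ 1 ∧ ‖l‖ ≤ (1 + δ) * μ.real Set.univ ^ p.toReal⁻¹ ∧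
      ∀ f, W (inclLinftyLp μ p f) = A (diagOp l (B f)) := by
  set t := geomTail 1 δ with ht
  have ht0 : ∀ k, 0 < t k := geomTail_one_pos hδ
  -- The `k`-th remainder is at most `t_k ^ 2`: one factor `t_k` goes to the weights, and the other
  -- one makes the series defining `A` converge.
  obtain ⟨V, π, hπ, hV0, hV⟩ := exists_remainder_seq hp W hW (ε := fun k => t (k + 1) ^ 2)
    fun k => pow_pos (ht0 _) 2
  obtain ⟨l, hl, hlm⟩ := exists_fiberWeights (μ := μ) hp hπ hδ hδ1
  let D : ℕ → ellP p →L[ℝ] E := fun k =>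
    (t k)⁻¹ • ((V k).comp (fiberEmbed μ p hp (hπ k))).comp
      (lpReindex p hp (Nat.pair k) (pair_left_injective k))
  let B := linftyGlue (fun k => fiberMean μ (π k)) fun k => norm_fiberMean_le μ (π k)
  have hD : ∀ k, ‖D k‖ ≤ geomTail ‖W‖ δ k := fun k => by
    have h1 : ‖D k‖ ≤ (t k)⁻¹ * ‖V k‖ := by
      refine (norm_smul_le _ _).trans ?_
      rw [Real.norm_of_nonneg (inv_nonneg.2 (ht0 k).le)]
      refine mul_le_mul_of_nonneg_left ?_ (inv_nonneg.2 (ht0 k).le)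
      refine (ContinuousLinearMap.opNorm_comp_le _ _).trans ?_
      refine (mul_le_of_le_one_right (norm_nonneg _) (norm_lpReindex_le hp _)).trans ?_
      refine (ContinuousLinearMap.opNorm_comp_le _ _).trans ?_
      exact mul_le_of_le_one_right (norm_nonneg _) (norm_fiberEmbed_le μ p hp _)
    refine h1.trans ?_
    cases k with
    | zero =>
      rw [hV0]
      simp [ht, geomTail]
    | succ k =>
      refine (mul_le_mul_of_nonneg_left (hV k).2 (inv_nonneg.2 (ht0 _).le)).trans_eq ?_
      rw [sq, inv_mul_cancel_left₀ (ht0 _).ne']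
      rfl
  have hDs : Summable D := Summable.of_norm_bounded (hasSum_geomTail ‖W‖ δ).summable hD
  refine ⟨∑' k, D k, B, l, tsum_of_norm_bounded (hasSum_geomTail ‖W‖ δ) hD,
    norm_linftyGlue_le _ _, hl, fun f => ?_⟩
  set g := inclLinftyLp μ p f with hg
  have hR : ∀ k, lpReindex p hp (Nat.pair k) (pair_left_injective k) (diagOp l (B f)) =
      t k • fiberCoord μ p hp (hπ k) g := fun k => by
    ext n
    rw [lpReindex_apply, diagOp_apply, hlm, linftyGlue_apply, Nat.unpair_pair]
    change _ = t k * fiberCoord μ p hp (hπ k) g n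
    rw [hg, fiberCoord_incl_apply, mul_assoc]
  have hDk : ∀ k, D k (diagOp l (B f)) = V k g - V (k + 1) g := fun k => by
    rw [(hV k).1]
    change (t k)⁻¹ • V k (fiberEmbed μ p hp (hπ k) (lpReindex p hp (Nat.pair k)
      (pair_left_injective k) (diagOp l (B f)))) = _
    rw [hR, map_smul, map_smul, smul_smul, inv_mul_cancel₀ (ht0 k).ne', one_smul,
      sub_apply, sub_sub_cancel]
    rfl
  have h1 : Filter.Tendsto (fun n => ∑ k ∈ Finset.range n, D k (diagOp l (B f))) Filter.atTop
      (nhds ((∑' k, D k) (diagOp l (B f)))) :=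
    (hDs.hasSum.mapL (ContinuousLinearMap.apply ℝ E (diagOp l (B f)))).tendsto_sum_nat
  have hVlim : Filter.Tendsto (fun n => V n g) Filter.atTop (nhds 0) := by
    rw [← Filter.tendsto_add_atTop_iff_nat 1]
    have htl : Filter.Tendsto (fun n => t (n + 1) ^ 2 * ‖g‖) Filter.atTop (nhds 0) := by
      have := (((Filter.tendsto_add_atTop_iff_nat 1).2
        (hasSum_geomTail 1 δ).summable.tendsto_atTop_zero).pow 2).mul_const ‖g‖
      simpa using this
    exact squeeze_zero_norm (fun n => (V (n + 1)).le_of_opNorm_le (hV n).2 g) htl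
  have h2 : Filter.Tendsto (fun n => ∑ k ∈ Finset.range n, D k (diagOp l (B f))) Filter.atTop
      (nhds (W g)) := by
    simp only [hDk, Finset.sum_range_sub', hV0]
    simpa using hVlim.const_sub (W g)
  exact tendsto_nhds_unique h2 h1

end Nuclear

/-! ### Compact operators and the bidual -/

section Bidual

variable {Z E F : Type*} [NormedAddCommGroup Z] [NormedSpace ℝ Z] [NormedAddCommGroup E]
  [NormedSpace ℝ E] [NormedAddCommGroup F] [NormedSpace ℝ F]

/-- Helly's lemma: a functional in the unit ball of the bidual is matched exactly, on finitely many
functionals of the form `y ∘ v`, by a point of the compact convex closure of `v` of the ball. -/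
theorem exists_mem_closure_image_ball_finite (v : Z →L[ℝ] E)
    (hv : IsCompact (closure (v '' Metric.closedBall 0 1)))
    {ζ : StrongDual ℝ (StrongDual ℝ Z)} (hζ : ‖ζ‖ ≤ 1) (s : Finset (StrongDual ℝ E)) :
    ∃ e ∈ closure (v '' Metric.closedBall 0 1), ∀ y ∈ s, y e = ζ (y.comp v) := by
  classical
  set K := closure (v '' Metric.closedBall (0 : Z) 1)
  have hKc : Convex ℝ K := ((convex_closedBall (0 : Z) 1).linear_image v.toLinearMap).closure
  let Ψ : E →L[ℝ] (s → ℝ) := ContinuousLinearMap.pi fun y => (y : StrongDual ℝ E)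
  by_contra hne
  have hx : (fun y : s => ζ ((y : StrongDual ℝ E).comp v)) ∉ Ψ '' K := by
    rintro ⟨e, he, h⟩
    exact hne ⟨e, he, fun y hy => congrFun h ⟨y, hy⟩⟩
  obtain ⟨f, u, hf, hfu⟩ := geometric_hahn_banach_closed_point
    (hKc.linear_image Ψ.toLinearMap) (hv.image Ψ.continuous).isClosed hx
  let a : s → ℝ := fun i => f fun j => if i = j then 1 else 0
  have hfa : ∀ w : s → ℝ, f w = ∑ i, w i * a i := fun w =>
    f.toLinearMap.pi_apply_eq_sum_univ w
  let y₀ : StrongDual ℝ E := ∑ i, a i • (i : StrongDual ℝ E)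
  have hy₀ : ∀ e, f (Ψ e) = y₀ e := fun e => by
    rw [hfa]
    simp [y₀, Ψ, mul_comm]
  have h1 : f (fun y : s => ζ ((y : StrongDual ℝ E).comp v)) = ζ (y₀.comp v) := by
    rw [hfa, ContinuousLinearMap.finsetSum_comp, map_sum]
    refine Finset.sum_congr rfl fun i _ => ?_
    rw [ContinuousLinearMap.smul_comp, map_smul, smul_eq_mul, mul_comm]
  have hmem : ∀ z : Z, ‖z‖ ≤ 1 → y₀ (v z) < u := fun z hz =>
    hy₀ (v z) ▸ hf _ ⟨v z, subset_closure ⟨z, by simpa using hz, rfl⟩, rfl⟩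
  have hu : 0 ≤ u := by simpa using (hmem 0 (by simp)).le
  have hn : ‖y₀.comp v‖ ≤ u := by
    refine ContinuousLinearMap.opNorm_le_of_unit_norm hu fun z hz => ?_
    rw [Real.norm_eq_abs, abs_le]
    have h2 := hmem z hz.le
    have h3 := hmem (-z) (by simp [hz])
    simp only [map_neg] at h3
    simp only [ContinuousLinearMap.comp_apply]
    constructor <;> linarith
  have h2 := (le_abs_self _).trans (ζ.le_of_opNorm_le hζ (y₀.comp v))
  rw [h1] at hfu
  linarith

theorem exists_mem_closure_image_ball (v : Z →L[ℝ] E)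
    (hv : IsCompact (closure (v '' Metric.closedBall 0 1)))
    {ζ : StrongDual ℝ (StrongDual ℝ Z)} (hζ : ‖ζ‖ ≤ 1) :
    ∃ e ∈ closure (v '' Metric.closedBall 0 1), ∀ y : StrongDual ℝ E, y e = ζ (y.comp v) := by
  obtain ⟨e, he, h⟩ := hv.inter_iInter_nonempty
    (fun y : StrongDual ℝ E => {e | y e = ζ (y.comp v)})
    (fun y => isClosed_eq y.continuous continuous_const) fun s => by
      obtain ⟨e, he, h⟩ := exists_mem_closure_image_ball_finite v hv hζ s
      exact ⟨e, he, Set.mem_iInter₂.2 h⟩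
  exact ⟨e, he, fun y => Set.mem_iInter.1 h y⟩

/-- The bitranspose of a compact operator `v : Z → E` takes values in `E`; composing it with
`A : F → Z**` gives a compact operator `F → E`. -/
theorem exists_compact_bitranspose_comp (v : Z →L[ℝ] E) (hv : IsCompactOperator v)
    (A : F →L[ℝ] StrongDual ℝ (StrongDual ℝ Z)) :
    ∃ W : F →L[ℝ] E, IsCompactOperator W ∧ ‖W‖ ≤ ‖v‖ * ‖A‖ ∧
      ∀ (f : F) (y : StrongDual ℝ E), y (W f) = A f (y.comp v) := by
  have hK : IsCompact (closure (v '' Metric.closedBall 0 1)) :=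
    hv.isCompact_closure_image_closedBall (f := v.toLinearMap) 1
  set K := closure (v '' Metric.closedBall (0 : Z) 1)
  have hex : ∀ (c : ℝ), 0 < c → ∀ f : F, ‖A f‖ ≤ c →
      ∃ e ∈ (fun e => c • e) '' K, ∀ y : StrongDual ℝ E, y e = A f (y.comp v) := fun c hc f hf => by
    obtain ⟨e, he, h⟩ := exists_mem_closure_image_ball v hK (ζ := c⁻¹ • A f) (by
      rw [norm_smul, norm_inv, Real.norm_of_nonneg hc.le, inv_mul_le_iff₀ hc, mul_one]
      exact hf)
    refine ⟨c • e, ⟨e, he, rfl⟩, fun y => ?_⟩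
    rw [map_smul, h y, smul_apply, smul_smul, mul_inv_cancel₀ hc.ne', one_smul]
  have hex' : ∀ f : F, ∃ e : E, ∀ y : StrongDual ℝ E, y e = A f (y.comp v) := fun f => by
    obtain ⟨e, -, h⟩ := hex (‖A f‖ + 1) (by positivity) f (by linarith)
    exact ⟨e, h⟩
  choose w hw using hex'
  have huniq : ∀ a b : E, (∀ y : StrongDual ℝ E, y a = y b) → a = b := fun a b h =>
    (SeparatingDual.eq_iff_forall_dual_eq (R := ℝ)).2 h
  let W : F →L[ℝ] E := LinearMap.mkContinuous
    { toFun := w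
      map_add' := fun f g => huniq _ _ fun y => by simp [hw]
      map_smul' := fun c f => huniq _ _ fun y => by simp [hw] }
    (‖v‖ * ‖A‖) fun f => by
      change ‖w f‖ ≤ _
      obtain ⟨y, hy, hyf⟩ := exists_dual_vector'' ℝ (w f)
      have hyf' : ‖w f‖ = A f (y.comp v) := by rw [← hw]; exact hyf.symm
      rw [hyf']
      have h1 : ‖y.comp v‖ ≤ ‖v‖ := (ContinuousLinearMap.opNorm_comp_le _ _).trans
        (mul_le_of_le_one_left (norm_nonneg _) hy)
      calc A f (y.comp v) ≤ ‖A f‖ * ‖y.comp v‖ := (le_abs_self _).trans ((A f).le_opNorm _)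
        _ ≤ (‖A‖ * ‖f‖) * ‖v‖ := by gcongr; exact A.le_opNorm f
        _ = _ := by ring
  refine ⟨W, ?_, LinearMap.mkContinuous_norm_le _ (by positivity) _, hw⟩
  refine (isCompactOperator_iff_image_closedBall_subset_compact W.toLinearMap one_pos).2
    ⟨_, hK.image (continuous_const_smul (‖A‖ + 1)), ?_⟩
  rintro _ ⟨f, hf, rfl⟩
  rw [mem_closedBall_zero_iff] at hf
  obtain ⟨e, he, h⟩ := hex (‖A‖ + 1) (by positivity) f
    (((A.le_opNorm f).trans (mul_le_of_le_one_right (norm_nonneg _) hf)).trans (by linarith))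
  have : W f = e := huniq _ _ fun y => by rw [h y]; exact hw f y
  exact this ▸ he

end Bidual

/-! ### Splitting a null sequence off a `p`-summable sequence -/

/-- A `p`-summable sequence stays `p`-summable after multiplication by a suitable sequence tending
to infinity. With `ρ_n` the tails of a positive summable sequence `a`, the sequence `a_n / √ρ_n` is
summable because `a_n = ρ_n - ρ_{n+1} ≤ 2 √ρ_n (√ρ_n - √ρ_{n+1})` telescopes. -/
theorem exists_memℓp_mul_tendsto_atTop {p : ℝ≥0∞} [Fact (1 ≤ p)] (hp : p ≠ ∞) (l : ellP p) :
    ∃ d : ℕ → ℝ, (∀ n, 0 ≤ d n) ∧ Filter.Tendsto d Filter.atTop Filter.atTop ∧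
      Memℓp (fun n => l n * d n) p := by
  have hr := toReal_pos_of_one_le hp
  -- the geometric term only makes the tails positive
  let a : ℕ → ℝ := fun n => ‖l n‖ ^ p.toReal + (1 / 2) ^ n
  have ha0 : ∀ n, 0 < a n := fun n => by positivity
  have has : Summable a := ((lp.memℓp l).summable hr).add summable_geometric_two
  let ρ : ℕ → ℝ := fun n => ∑' k, a (k + n)
  have hsn : ∀ n, Summable fun k => a (k + n) := fun n => (summable_nat_add_iff n).2 has
  have hρ0 : ∀ n, 0 < ρ n := fun n => (hsn n).tsum_pos (fun k => (ha0 _).le) 0 (ha0 _)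
  have hρs : ∀ n, ρ n = a n + ρ (n + 1) := fun n => by
    have h := (hsn n).tsum_eq_zero_add
    simp only [zero_add] at h
    refine h.trans ?_
    congr 1
    exact tsum_congr fun k => by congr 1; ring
  have hρt : Filter.Tendsto ρ Filter.atTop (nhds 0) := tendsto_sum_nat_add a
  refine ⟨fun n => (√(ρ n))⁻¹ ^ p.toReal⁻¹, fun n => by positivity, ?_, ?_⟩
  · refine (tendsto_rpow_atTop (inv_pos.2 hr)).comp (Filter.Tendsto.comp tendsto_inv_nhdsGT_zero ?_)
    refine tendsto_nhdsWithin_iff.2 ⟨?_, Filter.Eventually.of_forall fun n =>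
      Real.sqrt_pos.2 (hρ0 n)⟩
    simpa using hρt.sqrt
  · refine memℓp_gen ?_
    refine summable_of_sum_range_le (c := 2 * √(ρ 0)) (fun n => by positivity) fun n => ?_
    have hterm : ∀ k, ‖l k * (√(ρ k))⁻¹ ^ p.toReal⁻¹‖ ^ p.toReal ≤
        2 * √(ρ k) - 2 * √(ρ (k + 1)) := fun k => by
      have hs : 0 < √(ρ k) := Real.sqrt_pos.2 (hρ0 k)
      rw [norm_mul, Real.norm_of_nonneg (by positivity : 0 ≤ (√(ρ k))⁻¹ ^ p.toReal⁻¹),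
        Real.mul_rpow (norm_nonneg _) (by positivity), Real.rpow_inv_rpow (by positivity) hr.ne',
        mul_inv_le_iff₀ hs]
      have h1 : ‖l k‖ ^ p.toReal ≤ a k := le_add_of_nonneg_right (by positivity)
      have h2 := hρs k
      have h3 := Real.sq_sqrt (hρ0 k).le
      have h4 := Real.sq_sqrt (hρ0 (k + 1)).le
      nlinarith [sq_nonneg (√(ρ k) - √(ρ (k + 1)))]
    refine (Finset.sum_le_sum fun k _ => hterm k).trans ?_
    rw [Finset.sum_range_sub']
    have := Real.sqrt_nonneg (ρ n)
    linarith

theorem exists_null_mul_eq {p : ℝ≥0∞} [Fact (1 ≤ p)] (hp : p ≠ ∞) (l : ellP p) {ε : ℝ}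
    (hε : 0 < ε) :
    ∃ (α : ℕ → ℝ) (l' : ellP p), (∀ n, ‖α n‖ ≤ 1) ∧ Filter.Tendsto α Filter.atTop (nhds 0) ∧
      (∀ n, 0 ≤ l' n) ∧ ‖l'‖ ≤ ‖l‖ + ε ∧ ∀ n, l n = α n * l' n := by
  have hp0 : p ≠ 0 := (zero_lt_one.trans_le (Fact.out : 1 ≤ p)).ne'
  obtain ⟨d, hd0, hdt, hdm⟩ := exists_memℓp_mul_tendsto_atTop hp l
  let u : ellP p := ⟨fun n => ‖l n‖, memℓp_norm_iff.2 (lp.memℓp l)⟩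
  let w : ellP p := ⟨fun n => ‖l n * d n‖, memℓp_norm_iff.2 hdm⟩
  set η : ℝ := ε / (‖w‖ + 1) with hη
  have hη0 : 0 < η := by positivity
  have hden : ∀ n, 1 ≤ 1 + η * d n := fun n => le_add_of_nonneg_right (mul_nonneg hη0.le (hd0 n))
  have hl' : ∀ n, (u + η • w : ellP p) n = ‖l n‖ * (1 + η * d n) := fun n => by
    change ‖l n‖ + η * ‖l n * d n‖ = _
    rw [norm_mul, Real.norm_of_nonneg (hd0 n)]
    ring
  have hα : ∀ n, ‖l n / (u + η • w : ellP p) n‖ ≤ (1 + η * d n)⁻¹ := fun n => by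
    have h1 := zero_lt_one.trans_le (hden n)
    rw [hl', norm_div, norm_mul, norm_norm, Real.norm_of_nonneg h1.le]
    rcases eq_or_ne (‖l n‖) 0 with h0 | h0
    · rw [h0]
      simpa using h1.le
    · rw [div_mul_cancel_left₀ h0]
  refine ⟨fun n => l n / (u + η • w : ellP p) n, u + η • w,
    fun n => (hα n).trans (inv_le_one_of_one_le₀ (hden n)), ?_, fun n => ?_, ?_, fun n => ?_⟩
  · refine squeeze_zero_norm hα (tendsto_inv_atTop_zero.comp ?_)
    exact Filter.tendsto_atTop_add_const_left _ _ (hdt.const_mul_atTop hη0)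
  · rw [hl']
    exact mul_nonneg (norm_nonneg _) (zero_le_one.trans (hden n))
  · refine (norm_add_le _ _).trans (add_le_add ?_ ?_)
    · exact lp.norm_mono hp0 fun n => by
        change ‖‖l n‖‖ ≤ _
        rw [norm_norm]
    · rw [norm_smul, Real.norm_of_nonneg hη0.le, hη, div_mul_eq_mul_div,
        div_le_iff₀ (by positivity)]
      nlinarith [norm_nonneg w]
  · rw [div_mul_cancel_of_imp]
    intro h0
    rw [hl'] at h0
    simpa using (mul_eq_zero.1 h0).resolve_right (zero_lt_one.trans_le (hden n)).ne'

theorem norm_mul_le_of_norm_le_one {α : ℕ → ℝ} (hα : ∀ n, ‖α n‖ ≤ 1) (x : ℕ → ℝ) (n : ℕ) :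
    ‖α n * x n‖ ≤ ‖x n‖ := by
  rw [norm_mul]
  exact mul_le_of_le_one_left (norm_nonneg _) (hα n)

/-- The multiplication operator on `ℓ_p` by a sequence bounded by `1`. -/
noncomputable def lpMul (p : ℝ≥0∞) [Fact (1 ≤ p)] (α : ℕ → ℝ) (hα : ∀ n, ‖α n‖ ≤ 1) :
    ellP p →L[ℝ] ellP p :=
  LinearMap.mkContinuous (σ := RingHom.id ℝ)
    { toFun := fun x => ⟨fun n => α n * x n,
        Memℓp.mono' (g := fun n => x n) (lp.memℓp x) (norm_mul_le_of_norm_le_one hα x)⟩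
      map_add' := fun x y => by
        ext n
        exact mul_add (α n) (x n) (y n)
      map_smul' := fun c x => by
        ext n
        exact mul_left_comm (α n) c (x n) }
    1 (fun x => by
      rw [one_mul]
      exact lp.norm_mono (zero_lt_one.trans_le (Fact.out : 1 ≤ p)).ne'
        (norm_mul_le_of_norm_le_one hα x))

theorem lpMul_apply {p : ℝ≥0∞} [Fact (1 ≤ p)] {α : ℕ → ℝ} (hα : ∀ n, ‖α n‖ ≤ 1) (x : ellP p)
    (n : ℕ) : lpMul p α hα x n = α n * x n := rfl

theorem norm_lpMul_le {p : ℝ≥0∞} [Fact (1 ≤ p)] {α : ℕ → ℝ} (hα : ∀ n, ‖α n‖ ≤ 1) :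
    ‖lpMul p α hα‖ ≤ 1 :=
  LinearMap.mkContinuous_norm_le _ zero_le_one _

/-- The rank-one operator on `ℓ_p` which multiplies the `k`-th coordinate by `c` and annihilates the
other ones. -/
noncomputable def lpCoord (p : ℝ≥0∞) [Fact (1 ≤ p)] (c : ℝ) (k : ℕ) : ellP p →L[ℝ] ellP p :=
  c • (lp.singleContinuousLinearMap ℝ (fun _ : ℕ => ℝ) p k).comp
    (lp.evalCLM ℝ (fun _ : ℕ => ℝ) p k)

theorem lpCoord_apply {p : ℝ≥0∞} [Fact (1 ≤ p)] (c : ℝ) (k n : ℕ) (x : ellP p) :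
    lpCoord p c k x n = if n = k then c * x n else 0 := by
  change c * (lp.single p k (x k) : ellP p) n = _
  rw [lp.single_apply]
  by_cases h : n = k
  · subst h
    simp
  · simp [h]

theorem isCompactOperator_lpCoord {p : ℝ≥0∞} [Fact (1 ≤ p)] (c : ℝ) (k : ℕ) :
    IsCompactOperator (lpCoord p c k) := by
  have h : IsCompactOperator (lp.singleContinuousLinearMap ℝ (fun _ : ℕ => ℝ) p k) :=
    isCompactOperator_of_locallyCompactSpace_rng _
  exact (h.comp_clm (lp.evalCLM ℝ (fun _ : ℕ => ℝ) p k)).smul c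

theorem sum_lpCoord_apply {p : ℝ≥0∞} [Fact (1 ≤ p)] (α : ℕ → ℝ) (N n : ℕ) (x : ellP p) :
    (∑ k ∈ Finset.range N, lpCoord p (α k) k) x n = if n < N then α n * x n else 0 := by
  rw [sum_apply, lp.coeFn_sum, Finset.sum_apply]
  simp only [lpCoord_apply, Finset.sum_ite_eq, Finset.mem_range]

theorem norm_sum_lpCoord_sub_lpMul_le {p : ℝ≥0∞} [Fact (1 ≤ p)] {α : ℕ → ℝ}
    (hα : ∀ n, ‖α n‖ ≤ 1) {ε : ℝ} (hε : 0 ≤ ε) {N : ℕ} (hN : ∀ n, N ≤ n → ‖α n‖ ≤ ε) :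
    ‖(∑ k ∈ Finset.range N, lpCoord p (α k) k) - lpMul p α hα‖ ≤ ε := by
  refine ContinuousLinearMap.opNorm_le_bound _ hε fun x => ?_
  have h1 : ‖((∑ k ∈ Finset.range N, lpCoord p (α k) k) - lpMul p α hα) x‖ ≤ ‖ε • x‖ := by
    refine lp.norm_mono (zero_lt_one.trans_le (Fact.out : 1 ≤ p)).ne' fun n => ?_
    rw [sub_apply, lp.coeFn_sub, Pi.sub_apply, sum_lpCoord_apply, lpMul_apply, lp.coeFn_smul,
      Pi.smul_apply, smul_eq_mul, norm_mul, Real.norm_of_nonneg hε]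
    split_ifs with h
    · rw [sub_self, norm_zero]
      positivity
    · rw [zero_sub, norm_neg, norm_mul]
      exact mul_le_mul_of_nonneg_right (hN n (not_lt.1 h)) (norm_nonneg _)
  rwa [norm_smul, Real.norm_of_nonneg hε] at h1

theorem isCompactOperator_lpMul {p : ℝ≥0∞} [Fact (1 ≤ p)] {α : ℕ → ℝ} (hα : ∀ n, ‖α n‖ ≤ 1)
    (h0 : Filter.Tendsto α Filter.atTop (nhds 0)) : IsCompactOperator (lpMul p α hα) := by
  have hc : ∀ N, IsCompactOperator
      (∑ k ∈ Finset.range N, lpCoord p (α k) k : ellP p →L[ℝ] ellP p) := fun N => by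
    induction N with
    | zero => exact isCompactOperator_zero
    | succ N ih =>
      rw [Finset.sum_range_succ]
      exact ih.add (isCompactOperator_lpCoord (α N) N)
  refine isCompactOperator_of_tendsto (l := Filter.atTop)
    (F := fun N => ∑ k ∈ Finset.range N, lpCoord p (α k) k) ?_ (Filter.Eventually.of_forall hc)
  rw [tendsto_iff_norm_sub_tendsto_zero]
  rw [Metric.tendsto_atTop] at h0 ⊢
  intro ε hε
  obtain ⟨N₀, hN₀⟩ := h0 (ε / 2) (by positivity)
  refine ⟨N₀, fun N hN => ?_⟩
  rw [Real.dist_eq, sub_zero, abs_norm]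
  refine lt_of_le_of_lt (norm_sum_lpCoord_sub_lpMul_le hα (by positivity) fun n hn => ?_)
    (half_lt_self hε)
  simpa using (hN₀ n (hN.trans hn)).le

/-! ### Discrete measures turn diagonal operators into integral ones -/

section Discrete

variable {Ω : Type*} [MeasurableSpace Ω] (μ : Measure Ω) [IsFiniteMeasure μ] {π : Ω → ℕ}

omit [IsFiniteMeasure μ] in
theorem memLp_comp_linfty (hπ : Measurable π) (y : ellP ∞) : MemLp (fun ω => y (π ω)) ∞ μ :=
  memLp_top_of_bound ((measurable_of_countable (fun n => y n)).comp hπ).aestronglyMeasurable ‖y‖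
    (ae_of_all _ fun ω => lp.norm_apply_le_norm ENNReal.top_ne_zero y (π ω))

/-- Composition with `π`, from `ℓ_∞` to `L_∞(μ)`. -/
noncomputable def linftyComp (hπ : Measurable π) : ellP ∞ →L[ℝ] Lp ℝ ∞ μ :=
  LinearMap.mkContinuous
    { toFun := fun y => (memLp_comp_linfty μ hπ y).toLp _
      map_add' := fun x y => by
        rw [← MemLp.toLp_add]
        exact MemLp.toLp_congr _ _ (ae_of_all _ fun ω => rfl)
      map_smul' := fun c x => by
        rw [RingHom.id_apply, ← MemLp.toLp_const_smul]
        exact MemLp.toLp_congr _ _ (ae_of_all _ fun ω => rfl) }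
    1 fun y => by
      change ‖(memLp_comp_linfty μ hπ y).toLp _‖ ≤ _
      rw [one_mul, Lp.norm_toLp]
      refine ENNReal.toReal_le_of_le_ofReal (norm_nonneg y) ?_
      rw [eLpNorm_exponent_top]
      refine eLpNormEssSup_le_of_ae_bound (ae_of_all _ fun ω => ?_)
      exact lp.norm_apply_le_norm ENNReal.top_ne_zero y (π ω)

omit [IsFiniteMeasure μ] in
theorem norm_linftyComp_le (hπ : Measurable π) : ‖linftyComp μ hπ‖ ≤ 1 :=
  LinearMap.mkContinuous_norm_le _ zero_le_one _

theorem fiberCoord_linftyComp_apply {p : ℝ≥0∞} [Fact (1 ≤ p)] (hp : p ≠ ∞) (hπ : Measurable π)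
    (y : ellP ∞) (n : ℕ) :
    fiberCoord μ p hp hπ (inclLinftyLp μ p (linftyComp μ hπ y)) n =
      μ.real (π ⁻¹' {n}) ^ p.toReal⁻¹ * y n := by
  have h : ∫ ω in π ⁻¹' {n}, linftyComp μ hπ y ω ∂μ = μ.real (π ⁻¹' {n}) * y n := by
    rw [setIntegral_congr_ae (g := fun _ => y n) (measurableSet_fiber hπ n), setIntegral_const,
      smul_eq_mul]
    filter_upwards [(memLp_comp_linfty μ hπ y).coeFn_toLp] with ω hω hn
    refine Eq.trans hω ?_
    rw [hn]
  have hr := toReal_pos_of_one_le hp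
  rw [fiberCoord_apply, inclLinftyLp_coeFn, h]
  rcases (measureReal_nonneg : 0 ≤ μ.real (π ⁻¹' {n})).eq_or_lt with hm | hm
  · simp [← hm, hr.ne']
  · rw [Real.rpow_sub_one hm.ne']
    field_simp

end Discrete

/-- The measure on (a copy of) `ℕ` with the `p`-th powers of a nonnegative sequence of `ℓ_p` as
point masses. -/
theorem exists_discrete_measure {p : ℝ≥0∞} [Fact (1 ≤ p)] (hp : p ≠ ∞) (l : ellP p)
    (hl : ∀ n, 0 ≤ l n) :
    ∃ (μ : Measure (ULift.{t} ℕ)) (_ : IsFiniteMeasure μ),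
      (∀ n, μ.real (ULift.down ⁻¹' {n}) ^ p.toReal⁻¹ = l n) ∧
        μ.real Set.univ ^ p.toReal⁻¹ = ‖l‖ := by
  have hr := toReal_pos_of_one_le hp
  let μ : Measure (ULift.{t} ℕ) := Measure.sum fun n : ℕ =>
    ENNReal.ofReal (l n ^ p.toReal) • Measure.dirac (ULift.up n)
  have hs := lp.hasSum_norm hr l
  simp only [fun n => Real.norm_of_nonneg (hl n)] at hs
  have hμ : μ Set.univ = ENNReal.ofReal (‖l‖ ^ p.toReal) := by
    rw [Measure.sum_apply _ MeasurableSet.univ]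
    simp only [Measure.smul_apply, measure_univ, smul_eq_mul, mul_one]
    rw [← ENNReal.ofReal_tsum_of_nonneg (fun n => Real.rpow_nonneg (hl n) _) hs.summable,
      hs.tsum_eq]
  refine ⟨μ, ⟨by rw [hμ]; exact ENNReal.ofReal_lt_top⟩, fun n => ?_, ?_⟩
  · have h : μ (ULift.down ⁻¹' {n}) = ENNReal.ofReal (l n ^ p.toReal) := by
      rw [Measure.sum_apply _ (measurable_down (MeasurableSet.singleton n)), tsum_eq_single n]
      · simp
      · intro m hm
        simp [hm]
    rw [measureReal_def, h, ENNReal.toReal_ofReal (Real.rpow_nonneg (hl n) _),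
      Real.rpow_rpow_inv (hl n) hr.ne']
  · rw [measureReal_def, hμ, ENNReal.toReal_ofReal (by positivity),
      Real.rpow_rpow_inv (norm_nonneg l) hr.ne']

/-! ### Nuclear maps and compact operators after integral maps -/

theorem slIntegralNorm_le {X : Type u} {Z : Type w} [MetricSpace X] {x₀ : X}
    [NormedAddCommGroup Z] [NormedSpace ℝ Z] {p : ℝ≥0∞} [Fact (1 ≤ p)] {L : X → Z}
    {Ω : Type t} [MeasurableSpace Ω] {μ : Measure Ω} [IsFiniteMeasure μ]
    {A : Lp ℝ p μ →L[ℝ] StrongDual ℝ (StrongDual ℝ Z)} {b : X → Lp ℝ ∞ μ}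
    (h : IsSLIntegralFactorization x₀ p L μ A b) :
    slIntegralNorm.{u, w, t} x₀ p L ≤ ‖A‖ * ‖inclLinftyLp μ p‖ * lipNorm b := by
  refine csInf_le ⟨0, ?_⟩ ⟨Ω, _, μ, _, A, b, h, rfl⟩
  rintro _ ⟨Ω, _, μ, _, A, b, -, rfl⟩
  exact mul_nonneg (by positivity) (lipNorm_nonneg b)

theorem slNuclearNorm_le {X : Type u} {E : Type v} [MetricSpace X] {x₀ : X}
    [NormedAddCommGroup E] [NormedSpace ℝ E] {p : ℝ≥0∞} [Fact (1 ≤ p)] {T : X → E}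
    {A : ellP p →L[ℝ] E} {b : X → ellP ∞} {l : ellP p}
    (h : IsSLNuclearFactorization x₀ p T A b l) :
    slNuclearNorm x₀ p T ≤ ‖A‖ * ‖diagOp l‖ * lipNorm b := by
  refine csInf_le ⟨0, ?_⟩ ⟨A, b, l, h, rfl⟩
  rintro _ ⟨A, b, l, -, rfl⟩
  exact mul_nonneg (by positivity) (lipNorm_nonneg b)

/-- A nuclear factorization gives a compact operator after an integral map: move a null sequence
from the diagonal operator to the operator following it. -/
theorem exists_compact_comp_integral {X : Type u} {E : Type v} [MetricSpace X] {x₀ : X}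
    [NormedAddCommGroup E] [NormedSpace ℝ E] {p : ℝ≥0∞} [Fact (1 ≤ p)] (hp : p ≠ ∞) {T : X → E}
    {A : ellP p →L[ℝ] E} {b : X → ellP ∞} {l : ellP p}
    (h : IsSLNuclearFactorization x₀ p T A b l) {ε : ℝ} (hε : 0 < ε) :
    ∃ (v : ULift.{w} (ellP p) →L[ℝ] E) (L : X → ULift.{w} (ellP p)),
      IsCompactOperator v ∧ IsSLIntegral.{u, w, t} x₀ p L ∧ T = v ∘ L ∧
        ‖v‖ * slIntegralNorm.{u, w, t} x₀ p L ≤ ‖A‖ * (‖l‖ + ε) * lipNorm b := by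
  obtain ⟨hb, hT⟩ := h
  obtain ⟨α, l', hα, hα0, hl', hl'n, hαl⟩ := exists_null_mul_eq hp l hε
  obtain ⟨μ, hμ, hμl, hμu⟩ := exists_discrete_measure.{t} hp l' hl'
  let down : ULift.{w} (ellP p) ≃ₗᵢ[ℝ] ellP p := LinearIsometryEquiv.ulift ℝ (ellP p)
  let up := down.symm
  let v : ULift.{w} (ellP p) →L[ℝ] E :=
    (A.comp (lpMul p α hα)).comp (down.toContinuousLinearEquiv : ULift.{w} (ellP p) →L[ℝ] ellP p)
  let U : ellP p →L[ℝ] ULift.{w} (ellP p) :=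
    (up.toContinuousLinearEquiv : ellP p →L[ℝ] ULift.{w} (ellP p))
  let L : X → ULift.{w} (ellP p) := fun x => U (diagOp l' (b x))
  let A' : Lp ℝ p μ →L[ℝ] StrongDual ℝ (StrongDual ℝ (ULift.{w} (ellP p))) :=
    (NormedSpace.inclusionInDoubleDual ℝ (ULift.{w} (ellP p))).comp
      (U.comp (fiberCoord μ p hp measurable_down))
  let b' : X → Lp ℝ ∞ μ := fun x => linftyComp μ measurable_down (b x)
  have hfac : IsSLIntegralFactorization x₀ p L μ A' b' := by
    refine ⟨hb.clm_comp _, fun x => ?_⟩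
    have e : fiberCoord μ p hp measurable_down (inclLinftyLp μ p (b' x)) = diagOp l' (b x) := by
      ext n
      rw [fiberCoord_linftyComp_apply, hμl, diagOp_apply]
    change _ = NormedSpace.inclusionInDoubleDual ℝ (ULift.{w} (ellP p))
      (U (fiberCoord μ p hp measurable_down (inclLinftyLp μ p (b' x))))
    rw [e]
  have hU : ‖U‖ ≤ 1 := ContinuousLinearMap.opNorm_le_bound _ zero_le_one fun x => by
    rw [one_mul]
    exact (up.norm_map x).le
  have hA' : ‖A'‖ ≤ 1 := by
    refine (ContinuousLinearMap.opNorm_comp_le _ _).trans (mul_le_one₀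
      (NormedSpace.inclusionInDoubleDual_norm_le ℝ _) (norm_nonneg _) ?_)
    exact (ContinuousLinearMap.opNorm_comp_le _ _).trans
      (mul_le_one₀ hU (norm_nonneg _) (norm_fiberCoord_le μ p hp _))
  have hv : ‖v‖ ≤ ‖A‖ := by
    refine ContinuousLinearMap.opNorm_le_bound _ (norm_nonneg A) fun x => ?_
    refine (A.le_opNorm _).trans (mul_le_mul_of_nonneg_left ?_ (norm_nonneg A))
    refine ((lpMul p α hα).le_of_opNorm_le (norm_lpMul_le hα) _).trans ?_
    rw [one_mul]
    exact (down.norm_map x).le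
  have hsi : slIntegralNorm.{u, w, t} x₀ p L ≤ (‖l‖ + ε) * lipNorm b := by
    refine (slIntegralNorm_le hfac).trans ?_
    have h1 : ‖inclLinftyLp μ p‖ ≤ ‖l‖ + ε := ((norm_inclLinftyLp_le μ p).trans_eq hμu).trans hl'n
    have h2 : lipNorm b' ≤ lipNorm b := lipNorm_clm_comp_le hb _ (norm_linftyComp_le μ _)
    have h3 : ‖A'‖ * ‖inclLinftyLp μ p‖ ≤ ‖l‖ + ε :=
      (mul_le_of_le_one_left (norm_nonneg _) hA').trans h1
    exact mul_le_mul h3 h2 (lipNorm_nonneg _) (by positivity)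
  refine ⟨v, L, ?_, ⟨(hb.clm_comp (diagOp l')).clm_comp U, _, _, μ, hμ, A', b', hfac⟩, ?_, ?_⟩
  · exact ((isCompactOperator_lpMul hα hα0).clm_comp A).comp_clm _
  · funext x
    rw [hT]
    change _ = A (lpMul p α hα (diagOp l' (b x)))
    congr 1
    ext n
    rw [lpMul_apply, diagOp_apply, diagOp_apply, hαl, mul_assoc]
  · rw [mul_assoc]
    have h0 : 0 ≤ (‖l‖ + ε) * lipNorm b := mul_nonneg (by positivity) (lipNorm_nonneg b)
    exact (mul_le_mul_of_nonneg_left hsi (norm_nonneg v)).trans (mul_le_mul_of_nonneg_right hv h0)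

/-- A compact operator after an integral map has nuclear factorizations which almost attain the
constant of a given integral factorization. -/
theorem exists_nuclear_factorization {X : Type u} {E : Type v} {Z : Type w} [MetricSpace X] {x₀ : X}
    [NormedAddCommGroup E] [NormedSpace ℝ E] [CompleteSpace E] [NormedAddCommGroup Z]
    [NormedSpace ℝ Z] {p : ℝ≥0∞} [Fact (1 ≤ p)] (hp : p ≠ ∞) {v : Z →L[ℝ] E}
    (hv : IsCompactOperator v) {L : X → Z} {Ω : Type t} [MeasurableSpace Ω] {μ : Measure Ω}
    [IsFiniteMeasure μ] {A : Lp ℝ p μ →L[ℝ] StrongDual ℝ (StrongDual ℝ Z)} {b : X → Lp ℝ ∞ μ}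
    (h : IsSLIntegralFactorization x₀ p L μ A b) {δ : ℝ} (hδ : 0 < δ) (hδ1 : δ ≤ 1) :
    ∃ (A' : ellP p →L[ℝ] E) (b' : X → ellP ∞) (l : ellP p),
      IsSLNuclearFactorization x₀ p (v ∘ L) A' b' l ∧
        ‖A'‖ * ‖diagOp l‖ * lipNorm b' ≤
          (‖v‖ * ‖A‖ + δ) * ((1 + δ) * ‖inclLinftyLp μ p‖) * lipNorm b := by
  obtain ⟨hb, hL⟩ := h
  obtain ⟨W, hWc, hWn, hW⟩ := exists_compact_bitranspose_comp v hv A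
  obtain ⟨A', B, l, hA', hB, hl, hfac⟩ := exists_diagonal_factorization hp W hWc hδ hδ1
  refine ⟨A', fun x => B (b x), l, ⟨hb.clm_comp B, fun x => ?_⟩, ?_⟩
  · rw [← hfac]
    refine (SeparatingDual.eq_iff_forall_dual_eq (R := ℝ)).2 fun y => ?_
    rw [hW, ← hL]
    rfl
  · rw [norm_diagOp]
    have h1 : ‖l‖ ≤ (1 + δ) * ‖inclLinftyLp μ p‖ :=
      hl.trans (mul_le_mul_of_nonneg_left (rpow_measureReal_univ_le_norm_incl μ p hp)
        (by positivity))
    refine mul_le_mul (mul_le_mul (hA'.trans (by linarith)) h1 (norm_nonneg _) (by positivity))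
      (lipNorm_clm_comp_le hb B hB) (lipNorm_nonneg _) (by positivity)

theorem slNuclearNorm_comp_le {X : Type u} {E : Type v} {Z : Type w} [MetricSpace X] {x₀ : X}
    [NormedAddCommGroup E] [NormedSpace ℝ E] [CompleteSpace E] [NormedAddCommGroup Z]
    [NormedSpace ℝ Z] {p : ℝ≥0∞} [Fact (1 ≤ p)] (hp : p ≠ ∞) {v : Z →L[ℝ] E}
    (hv : IsCompactOperator v) {L : X → Z} {Ω : Type t} [MeasurableSpace Ω] {μ : Measure Ω}
    [IsFiniteMeasure μ] {A : Lp ℝ p μ →L[ℝ] StrongDual ℝ (StrongDual ℝ Z)} {b : X → Lp ℝ ∞ μ}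
    (h : IsSLIntegralFactorization x₀ p L μ A b) :
    slNuclearNorm x₀ p (v ∘ L) ≤ ‖v‖ * (‖A‖ * ‖inclLinftyLp μ p‖ * lipNorm b) := by
  have hlim : Filter.Tendsto
      (fun δ : ℝ => (‖v‖ * ‖A‖ + δ) * ((1 + δ) * ‖inclLinftyLp μ p‖) * lipNorm b)
      (nhdsWithin 0 (Set.Ioi 0)) (nhds (‖v‖ * (‖A‖ * ‖inclLinftyLp μ p‖ * lipNorm b))) := by
    have hc : Continuous
        fun δ : ℝ => (‖v‖ * ‖A‖ + δ) * ((1 + δ) * ‖inclLinftyLp μ p‖) * lipNorm b := by fun_prop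
    have h0 := (hc.tendsto 0).mono_left (nhdsWithin_le_nhds (s := Set.Ioi 0))
    convert h0 using 2
    ring
  refine ge_of_tendsto hlim ?_
  filter_upwards [Ioc_mem_nhdsGT (zero_lt_one : (0 : ℝ) < 1)] with δ hδ
  obtain ⟨A', b', l, hfac, hle⟩ := exists_nuclear_factorization hp hv h hδ.1 hδ.2
  exact (slNuclearNorm_le hfac).trans hle

theorem slNuclearNorm_comp_le_mul_slIntegralNorm {X : Type u} {E : Type v} {Z : Type w}
    [MetricSpace X] {x₀ : X} [NormedAddCommGroup E] [NormedSpace ℝ E] [CompleteSpace E]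
    [NormedAddCommGroup Z] [NormedSpace ℝ Z] {p : ℝ≥0∞} [Fact (1 ≤ p)] (hp : p ≠ ∞) {v : Z →L[ℝ] E}
    (hv : IsCompactOperator v) {L : X → Z} (hL : IsSLIntegral.{u, w, t} x₀ p L) :
    slNuclearNorm x₀ p (v ∘ L) ≤ ‖v‖ * slIntegralNorm.{u, w, t} x₀ p L := by
  obtain ⟨-, Ω, _, μ, _, A, b, hfac⟩ := hL
  rcases (norm_nonneg v).eq_or_lt with h0 | h0
  · have h := slNuclearNorm_comp_le hp hv hfac
    rw [← h0, zero_mul] at h ⊢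
    exact h
  · rw [← div_le_iff₀' h0]
    refine le_csInf ⟨_, Ω, _, μ, _, A, b, hfac, rfl⟩ ?_
    rintro _ ⟨Ω, _, μ, _, A, b, hfac, rfl⟩
    rw [div_le_iff₀' h0]
    exact slNuclearNorm_comp_le hp hv hfac

theorem theorem2p13 {X : Type u} {E : Type v} [MetricSpace X] (x₀ : X)
    [NormedAddCommGroup E] [NormedSpace ℝ E] [CompleteSpace E]
    (p : ℝ≥0∞) [Fact (1 ≤ p)] (hp : p ≠ ∞) (T : X → E) (hT : IsLip0 x₀ T) :
    (IsSLNuclear x₀ p T ↔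
      ∃ (Z : Type w) (_ : NormedAddCommGroup Z) (_ : NormedSpace ℝ Z) (_ : CompleteSpace Z)
        (v : Z →L[ℝ] E) (L : X → Z),
        IsCompactOperator v ∧ IsSLIntegral.{u, w, t} x₀ p L ∧ T = v ∘ L) ∧
    (IsSLNuclear x₀ p T →
      IsGLB {c : ℝ | ∃ (Z : Type w) (_ : NormedAddCommGroup Z) (_ : NormedSpace ℝ Z)
          (_ : CompleteSpace Z) (v : Z →L[ℝ] E) (L : X → Z),
          IsCompactOperator v ∧ IsSLIntegral.{u, w, t} x₀ p L ∧ T = v ∘ L ∧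
          c = ‖v‖ * slIntegralNorm.{u, w, t} x₀ p L}
        (slNuclearNorm x₀ p T)) := by
  refine ⟨⟨?_, ?_⟩, ?_⟩
  · rintro ⟨-, A, b, l, h⟩
    obtain ⟨v, L, hv, hL, hTL, -⟩ := exists_compact_comp_integral.{u, v, w, t} hp h one_pos
    exact ⟨ULift.{w} (ellP p), _, _, inferInstance, v, L, hv, hL, hTL⟩
  · rintro ⟨Z, _, _, _, v, L, hv, ⟨-, Ω, _, μ, _, A, b, h⟩, rfl⟩
    obtain ⟨A', b', l, h', -⟩ := exists_nuclear_factorization hp hv h one_pos le_rfl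
    exact ⟨hT, A', b', l, h'⟩
  · rintro ⟨-, A₀, b₀, l₀, h₀⟩
    refine ⟨?_, fun m hm => le_csInf ⟨_, A₀, b₀, l₀, h₀, rfl⟩ ?_⟩
    · rintro _ ⟨Z, _, _, _, v, L, hv, hL, rfl, rfl⟩
      exact slNuclearNorm_comp_le_mul_slIntegralNorm hp hv hL
    · rintro _ ⟨A, b, l, h, rfl⟩
      rw [norm_diagOp]
      have hlim : Filter.Tendsto (fun ε : ℝ => ‖A‖ * (‖l‖ + ε) * lipNorm b)
          (nhdsWithin 0 (Set.Ioi 0)) (nhds (‖A‖ * ‖l‖ * lipNorm b)) := by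
        have hc : Continuous fun ε : ℝ => ‖A‖ * (‖l‖ + ε) * lipNorm b := by fun_prop
        simpa using (hc.tendsto 0).mono_left (nhdsWithin_le_nhds (s := Set.Ioi 0))
      refine ge_of_tendsto hlim ?_
      filter_upwards [self_mem_nhdsWithin] with ε hε
      obtain ⟨v, L, hv, hL, hTL, hle⟩ :=
        exists_compact_comp_integral.{u, v, w, t} hp h (Set.mem_Ioi.1 hε)
      exact (hm ⟨ULift.{w} (ellP p), _, _, inferInstance, v, L, hv, hL, hTL, rfl⟩).trans hle
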